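/- Let $I$ be a finite set and let $A=(a_{ij})_{i,j\in I}$ be a generalized Cartan matrix. Let $\mathfrak h_{\mathbb R}$ be a finite-dimensional real vector space with linearly independent simple coroots $h_i\in\mathfrak h_{\mathbb R}$ and linearly independent simple roots $\alpha_i\in\mathfrak h_{\mathbb R}^*$ $(i\in I)$ such that $\alpha_j(h_i)=a_{ij}$. Let $\mathcal W\subseteq GL(\mathfrak h_{\mathbb R}^*)$ be the Weyl group, generated by the simple reflections $\sigma_i\lambda=\lambda-\lambda(h_i)\alpha_i$, with length function $l$; for $J\subseteq I$ let $\mathcal W_J=\langle\sigma_i\mid i\in J\rangle$. Let $X=\mathcal W\,\overline C$ with $\overline C=\{\lambda\in\mathfrak h_{\mathbb R}^*\mid\lambda(h_i)\ge 0\text{ for all }i\in I\}$ be the Tits cone, and let $Fa(X)$ be the set of (nonempty) faces of the convex cone $X$, in the sense of convex geometry, ordered by inclusion. For $\Theta\subseteq I$ let $\Theta^\infty\subseteq\Theta$ be the union of the (indices of the) indecomposable components of the submatrix $A_\Theta$ which are not of finite type, and call $\Theta$ special if $\Theta=\Theta^\infty$. For $J\subseteq I$ put $J^\perp=\{i\in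 I\mid a_{ij}=0\text{ for all }j\in J\}$ and $\overline F_J=\{\lambda\in\overline C\mid\lambda(h_i)=0\text{ for all }i\in J\}$. For $\Theta$ special put $R(\Theta)=\mathcal W_{\Theta^\perp}\overline F_\Theta$; this is a face of $X$. For $\sigma\in\mathcal W$ let $red(\sigma)\subseteq I$ be the set of the indices occurring in a reduced expression of $\sigma$ (it does not depend on the reduced expression; $red(1)=\emptyset$). For $J,K\subseteq I$ let ${}^J\mathcal W^K$ be the set of those $\tau\in\mathcal W$ which are of minimal length in the double coset $\mathcal W_J\tau\mathcal W_K$. **Theorem.** Let $\Theta_1,\Theta_2\subseteq I$ be special and let $\tau\in{}^{\Theta_1\cup\Theta_1^\perp}\mathcal W^{\Theta_2\cup\Theta_2^\perp}$. Then $\Theta_1\cup\Theta_2\cup red(\tau)$ and $(\Theta_1\cap\tau\Theta_2)^\infty$ are special, where $\Theta_1\cap\tau\Theta_2=\{i\in\Theta_1\mid\alpha_i=\tau\alpha_j\text{ for some }j\in\Theta_2\}$, and $$R(\Theta_1)\cap\tau R(\Theta_2)=R(\Theta_1\cup\Theta_2\cup red(\tau)),\qquad R(\Theta_1)\vee\tau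 R(\Theta_2)=R\bigl((\Theta_1\cap\tau\Theta_2)^\infty\bigr),$$ where $\vee$ denotes the join in $Fa(X)$; that is, $R(\Theta_1)$, $\tau R(\Theta_2)$ and $R((\Theta_1\cap\tau\Theta_2)^\infty)$ are faces of $X$, and the last one is the least upper bound of the first two with respect to inclusion. -/

import Mathlib

open Module

noncomputable section

namespace KacMoody

/-- Generalized Cartan matrices. -/
structure IsGCM {I : Type*} (A : Matrix I I ℤ) : Prop where
  diag : ∀ i, A i i = 2
  nonpos : ∀ i j, i ≠ j → A i j ≤ 0
  zero_symm : ∀ i j, A i j = 0 → A j i = 0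

/-- The class (Fin) of the trichotomy (Fin) / (Aff) / (Ind). It is only applied to the
indecomposable components of a generalized Cartan matrix. -/
def IsFiniteType {J : Type*} [Fintype J] [DecidableEq J] (B : Matrix J J ℤ) : Prop :=
  B.det ≠ 0 ∧
  (∃ u : J → ℝ, (∀ i, 0 < u i) ∧ ∀ i, 0 < (B.map (Int.cast : ℤ → ℝ)).mulVec u i) ∧
  ∀ v : J → ℝ, (∀ i, 0 ≤ (B.map (Int.cast : ℤ → ℝ)).mulVec v i) → (∀ i, 0 < v i) ∨ v = 0

section Combinatorics

variable {I : Type*}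

/-- The underlying simple graph of the Dynkin diagram of `A`. -/
def dynkinGraph (A : Matrix I I ℤ) : SimpleGraph I where
  Adj i j := i ≠ j ∧ (A i j ≠ 0 ∨ A j i ≠ 0)
  symm := ⟨fun _ _ h => ⟨h.1.symm, h.2.symm⟩⟩
  loopless := ⟨fun _ h => h.1 rfl⟩

/-- The indices of the indecomposable component of the submatrix `A_Θ` which contains `i`
(empty if `i ∉ Θ`). -/
def component (A : Matrix I I ℤ) (Θ : Set I) (i : I) : Set I :=
  {j | ∃ (hi : i ∈ Θ) (hj : j ∈ Θ), ((dynkinGraph A).induce Θ).Reachable ⟨i, hi⟩ ⟨j, hj⟩}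

open Classical in
/-- `Θ^∞`: the indices in `Θ` which lie in a component of `A_Θ` of non-finite type. -/
def infPart [Fintype I] (A : Matrix I I ℤ) (Θ : Set I) : Set I :=
  {i | i ∈ Θ ∧
    ¬ IsFiniteType (A.submatrix (Subtype.val : component A Θ i → I) Subtype.val)}

/-- Special subsets of the index set: `Θ = Θ^∞`. -/
def IsSpecial [Fintype I] (A : Matrix I I ℤ) (Θ : Set I) : Prop :=
  Θ = infPart A Θ

/-- `J^⊥`. -/
def perp (A : Matrix I I ℤ) (J : Set I) : Set I :=
  {i | ∀ j ∈ J, A i j = 0}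

end Combinatorics

/-- A free realization over `ℝ` of `A` on the space `V` (the space `𝔥_ℝ`): simple coroots
`h i` in `V` and simple roots `α i` in the dual space, each family linearly independent, with
`α j (h i) = A i j`. -/
structure Realization {I : Type*} (A : Matrix I I ℤ)
    (V : Type*) [AddCommGroup V] [Module ℝ V] where
  h : I → V
  α : I → Dual ℝ V
  linearIndependent_h : LinearIndependent ℝ h
  linearIndependent_α : LinearIndependent ℝ α
  pairing : ∀ i j, α j (h i) = (A i j : ℝ)
  isGCM : IsGCM A

namespace Realization

variable {I V : Type*} [AddCommGroup V] [Module ℝ V] {A : Matrix I I ℤ}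

theorem eval_h_α (R : Realization A V) (i : I) : Dual.eval ℝ V (R.h i) (R.α i) = 2 := by
  simp [R.pairing, R.isGCM.diag]

/-- The simple reflection `λ ↦ λ - λ(h i) • α i` of the dual space. -/
def s (R : Realization A V) (i : I) : Dual ℝ V ≃ₗ[ℝ] Dual ℝ V :=
  Module.reflection (R.eval_h_α i)

/-- The parabolic subgroup `W_J`. -/
def parabolic (R : Realization A V) (J : Set I) : Subgroup (Dual ℝ V ≃ₗ[ℝ] Dual ℝ V) :=
  Subgroup.closure (R.s '' J)

/-- The Weyl group `W`, as a group of linear automorphisms of the dual space. -/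
def weylGroup (R : Realization A V) : Subgroup (Dual ℝ V ≃ₗ[ℝ] Dual ℝ V) :=
  Subgroup.closure (Set.range R.s)

/-- The product of the simple reflections along a word in the indices. -/
def wordProd (R : Realization A V) (ω : List I) : Dual ℝ V ≃ₗ[ℝ] Dual ℝ V :=
  (ω.map R.s).prod

/-- The length of an element of the Weyl group with respect to the simple reflections. -/
def length (R : Realization A V) (w : Dual ℝ V ≃ₗ[ℝ] Dual ℝ V) : ℕ :=
  sInf {n | ∃ ω : List I, ω.length = n ∧ R.wordProd ω = w}

/-- The set of indices which occur in reduced expressions of `w`. (All reduced expressions of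
`w` involve the same indices.) -/
def red (R : Realization A V) (w : Dual ℝ V ≃ₗ[ℝ] Dual ℝ V) : Set I :=
  {i | ∃ ω : List I, R.wordProd ω = w ∧ ω.length = R.length w ∧ i ∈ ω}

/-- The minimal double coset representatives `^J W ^K`: the elements `τ` of `W` which are of
minimal length in `W_J τ W_K`. -/
def minDoubleCosetReps (R : Realization A V) (J K : Set I) :
    Set (Dual ℝ V ≃ₗ[ℝ] Dual ℝ V) :=
  {τ | τ ∈ R.weylGroup ∧
    ∀ x ∈ R.parabolic J, ∀ y ∈ R.parabolic K, R.length τ ≤ R.length (x * τ * y)}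

/-- The closed fundamental chamber. -/
def closedChamber (R : Realization A V) : Set (Dual ℝ V) :=
  {l | ∀ i, 0 ≤ l (R.h i)}

/-- The closed facet of type `J` of the closed fundamental chamber. -/
def closedFacet (R : Realization A V) (J : Set I) : Set (Dual ℝ V) :=
  {l | (∀ i ∈ J, l (R.h i) = 0) ∧ ∀ i ∉ J, 0 ≤ l (R.h i)}

/-- The Tits cone `X`, the union of the `W`-translates of the closed fundamental chamber. -/
def titsCone (R : Realization A V) : Set (Dual ℝ V) :=
  {l | ∃ w ∈ R.weylGroup, ∃ m ∈ R.closedChamber, w m = l}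

/-- Faces of the Tits cone in the sense of convex geometry: nonempty convex extreme subsets. -/
def IsFace (R : Realization A V) (F : Set (Dual ℝ V)) : Prop :=
  F.Nonempty ∧ Convex ℝ F ∧ IsExtreme ℝ R.titsCone F

/-- The set `Fa(X)` of faces of the Tits cone, partially ordered by inclusion. -/
abbrev Faces (R : Realization A V) : Type _ :=
  {F : Set (Dual ℝ V) // R.IsFace F}

/-- `R(Θ)`, the union of the `W_{Θ^⊥}`-translates of the closed facet of type `Θ`. -/
def specialFace (R : Realization A V) (Θ : Set I) : Set (Dual ℝ V) :=
  {l | ∃ w ∈ R.parabolic (perp A Θ), ∃ m ∈ R.closedFacet Θ, w m = l}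

/-- `Θ₁ ∩ τ Θ₂`, where indices are identified with the corresponding simple roots. -/
def interTranslate (R : Realization A V) (Θ₁ : Set I) (τ : Dual ℝ V ≃ₗ[ℝ] Dual ℝ V)
    (Θ₂ : Set I) : Set I :=
  {i | i ∈ Θ₁ ∧ ∃ j ∈ Θ₂, R.α i = τ (R.α j)}

end Realization

end KacMoody

end

noncomputable section

namespace KacMoody.Realization

variable {I V : Type*} [AddCommGroup V] [Module ℝ V] {A : Matrix I I ℤ} (R : Realization A V)

/-! ### Words and lengths -/

/-! The proof rests on exposing vectors. By the trichotomy, a special Θ supports a vector v = ∑ c i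
• h i with c > 0 on Θ such that α j v ≤ 0 for all j, and α j v = 0 only for j ∈ Θ ∪ Θ^⊥. Along a
length-increasing chain in W, the value at v of a translated dominant weight does not decrease.
Hence v is nonnegative on the Tits cone X, and R(Θ) is the exposed face X ∩ {v = 0}
(`IsAntidominant.mem_specialFace_iff`).

Intersection: R(Θ₁) ∩ τ R(Θ₂) is the zero locus on X of N v₁ + τ v₂ for any N > 0. Minimality of τ
makes τ⁻¹ α j a positive root for j ∈ Θ₁ ∪ Θ₁^⊥; for the other j, v₁ is strictly negative on α j and
a large N dominates. So the sum is again antidominant, and its support turns out to be Θ₁ ∪ Θ₂ ∪ red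
τ (`exists_isAntidominant_union`).

Join: the simple coroots indexed by Θ₁ ∩ τ Θ₂ vanish on both faces, which gives an upper bound.
Conversely, a face containing both contains p = N m₁ + τ m₂ with m₁, m₂ generic in the two closed
facets. For large N this p is dominant, and the simple coroots vanishing at p are exactly those of J
= Θ₁ ∩ τ Θ₂. The Tits cone of a finite-type part is the whole space (`titsCone_eq_univ`), so p is
algebraically interior to R(J^∞), and a face through p contains R(J^∞).

Underneath lie the sign-coherence of real roots and coroots, obtained by reduction to rank two
(`IsSimpleSystem.act_mem_closure`), and the convexity of X, which follows from it. -/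

theorem s_apply (i : I) (l : Dual ℝ V) : R.s i l = l - l (R.h i) • R.α i := by
  simp [s, Module.reflection_apply]

theorem s_apply_apply (i : I) (l : Dual ℝ V) (v : V) :
    R.s i l v = l v - l (R.h i) * R.α i v := by
  simp [s_apply]

theorem s_mul_s (i : I) : R.s i * R.s i = 1 := by
  ext1 l
  exact Module.involutive_reflection _ l

theorem s_inv (i : I) : (R.s i)⁻¹ = R.s i :=
  inv_eq_of_mul_eq_one_left (R.s_mul_s i)

theorem s_mem_weylGroup (i : I) : R.s i ∈ R.weylGroup :=
  Subgroup.subset_closure ⟨i, rfl⟩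

theorem s_mem_parabolic {J : Set I} {i : I} (hi : i ∈ J) : R.s i ∈ R.parabolic J :=
  Subgroup.subset_closure ⟨i, hi, rfl⟩

theorem parabolic_mono {J K : Set I} (h : J ⊆ K) : R.parabolic J ≤ R.parabolic K :=
  Subgroup.closure_mono (Set.image_mono h)

theorem parabolic_le_weylGroup (J : Set I) : R.parabolic J ≤ R.weylGroup :=
  Subgroup.closure_mono (Set.image_subset_range _ _)

@[simp] theorem wordProd_nil : R.wordProd [] = 1 := rfl

@[simp] theorem wordProd_cons (i : I) (ω : List I) :
    R.wordProd (i :: ω) = R.s i * R.wordProd ω := by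
  simp [wordProd]

@[simp] theorem wordProd_append (ω ω' : List I) :
    R.wordProd (ω ++ ω') = R.wordProd ω * R.wordProd ω' := by
  simp [wordProd]

@[simp] theorem wordProd_reverse (ω : List I) :
    R.wordProd ω.reverse = (R.wordProd ω)⁻¹ := by
  induction ω with
  | nil => simp
  | cons i ω ih => simp [ih, s_inv]

theorem wordProd_mem_parabolic {J : Set I} {ω : List I} (h : ∀ i ∈ ω, i ∈ J) :
    R.wordProd ω ∈ R.parabolic J := by
  induction ω with
  | nil => exact one_mem _
  | cons i ω ih =>
    rw [wordProd_cons]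
    exact mul_mem (R.s_mem_parabolic (h i (by simp))) (ih fun j hj => h j (by simp [hj]))

theorem wordProd_mem_weylGroup (ω : List I) : R.wordProd ω ∈ R.weylGroup :=
  R.parabolic_le_weylGroup Set.univ (R.wordProd_mem_parabolic fun _ _ => trivial)

theorem exists_wordProd {w : Dual ℝ V ≃ₗ[ℝ] Dual ℝ V} (hw : w ∈ R.weylGroup) :
    ∃ ω : List I, R.wordProd ω = w := by
  induction hw using Subgroup.closure_induction with
  | mem x hx => obtain ⟨i, rfl⟩ := hx; exact ⟨[i], by simp⟩
  | one => exact ⟨[], rfl⟩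
  | mul x y _ _ hx hy =>
    obtain ⟨a, rfl⟩ := hx
    obtain ⟨b, rfl⟩ := hy
    exact ⟨a ++ b, by simp⟩
  | inv x _ hx => obtain ⟨a, rfl⟩ := hx; exact ⟨a.reverse, by simp⟩

theorem length_wordProd_le (ω : List I) : R.length (R.wordProd ω) ≤ ω.length :=
  Nat.sInf_le ⟨ω, rfl, rfl⟩

theorem exists_reduced {w : Dual ℝ V ≃ₗ[ℝ] Dual ℝ V} (hw : w ∈ R.weylGroup) :
    ∃ ω : List I, R.wordProd ω = w ∧ ω.length = R.length w := by
  obtain ⟨ω, h⟩ := R.exists_wordProd hw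
  obtain ⟨ω', h1, h2⟩ := Nat.sInf_mem (s := {n | ∃ ω : List I, ω.length = n ∧
    R.wordProd ω = w}) ⟨_, ω, rfl, h⟩
  exact ⟨ω', h2, h1⟩

variable {w v : Dual ℝ V ≃ₗ[ℝ] Dual ℝ V}

theorem length_mul_wordProd_le (hw : w ∈ R.weylGroup) (ω : List I) :
    R.length (w * R.wordProd ω) ≤ R.length w + ω.length := by
  obtain ⟨ω', rfl, h⟩ := R.exists_reduced hw
  rw [← h, ← List.length_append, ← wordProd_append]
  exact R.length_wordProd_le _

theorem length_mul_s_le (hw : w ∈ R.weylGroup) (i : I) :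
    R.length (w * R.s i) ≤ R.length w + 1 := by
  simpa using R.length_mul_wordProd_le hw [i]

theorem length_le_mul_s (hw : w ∈ R.weylGroup) (i : I) :
    R.length w ≤ R.length (w * R.s i) + 1 := by
  have := R.length_mul_s_le (mul_mem hw (R.s_mem_weylGroup i)) i
  rwa [mul_assoc, s_mul_s, mul_one] at this

theorem length_inv_le (hw : w ∈ R.weylGroup) : R.length w⁻¹ ≤ R.length w := by
  obtain ⟨ω, rfl, h⟩ := R.exists_reduced hw
  rw [← wordProd_reverse, ← h, ← List.length_reverse]
  exact R.length_wordProd_le _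

theorem length_inv (hw : w ∈ R.weylGroup) : R.length w⁻¹ = R.length w :=
  (R.length_inv_le hw).antisymm (by simpa using R.length_inv_le (inv_mem hw))

theorem length_s_mul (hw : w ∈ R.weylGroup) (i : I) :
    R.length (R.s i * w) = R.length (w⁻¹ * R.s i) := by
  rw [← R.length_inv (mul_mem (R.s_mem_weylGroup i) hw), mul_inv_rev, s_inv]

@[simp] theorem length_one : R.length (1 : Dual ℝ V ≃ₗ[ℝ] Dual ℝ V) = 0 :=
  Nat.le_zero.1 (R.length_wordProd_le [])

/-- A nontrivial element has a right descent. -/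
theorem exists_length_mul_s_lt (hw : w ∈ R.weylGroup) (h : w ≠ 1) :
    ∃ i, R.length (w * R.s i) < R.length w := by
  obtain ⟨ω, rfl, h'⟩ := R.exists_reduced hw
  rcases List.eq_nil_or_concat ω with rfl | ⟨ω, i, rfl⟩
  · exact absurd rfl h
  · refine ⟨i, ?_⟩
    rw [← h']
    simpa [mul_assoc, s_mul_s, Nat.lt_succ_iff] using R.length_wordProd_le ω

/-- Peels off right descents. Each step lengthens the element, so the sign of the corresponding root
is known inside the induction. -/
theorem weylGroup_induction_right {p : (Dual ℝ V ≃ₗ[ℝ] Dual ℝ V) → Prop} (one : p 1)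
    (mul : ∀ w i, w ∈ R.weylGroup → R.length w < R.length (w * R.s i) → p w → p (w * R.s i))
    (hw : w ∈ R.weylGroup) : p w := by
  induction hn : R.length w using Nat.strong_induction_on generalizing w with
  | _ n ih =>
    by_cases h1 : w = 1
    · rwa [h1]
    obtain ⟨i, hi⟩ := R.exists_length_mul_s_lt hw h1
    have hm := mul_mem hw (R.s_mem_weylGroup i)
    have := mul _ i hm (by rwa [mul_assoc, s_mul_s, mul_one]) (ih _ (hn ▸ hi) hm rfl)
    rwa [mul_assoc, s_mul_s, mul_one] at this

theorem weylGroup_induction_left {p : (Dual ℝ V ≃ₗ[ℝ] Dual ℝ V) → Prop} (one : p 1)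
    (mul : ∀ w i, w ∈ R.weylGroup → R.length w < R.length (R.s i * w) → p w → p (R.s i * w))
    (hw : w ∈ R.weylGroup) : p w := by
  suffices p (w⁻¹)⁻¹ by simpa using this
  refine R.weylGroup_induction_right (p := fun u => p u⁻¹) (by simpa) ?_ (inv_mem hw)
  intro u i hu hl hp
  rw [mul_inv_rev, s_inv]
  refine mul _ i (inv_mem hu) ?_ hp
  rwa [R.length_s_mul (inv_mem hu), R.length_inv hu, inv_inv]

end KacMoody.Realization

namespace KacMoody.Realization

variable {I V : Type*} [AddCommGroup V] [Module ℝ V] {A : Matrix I I ℤ} (R : Realization A V)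

/-! ### Alternating products in rank two -/

/-- The alternating product `⋯ s_i s_j` of `k` simple reflections. -/
def altProd (i j : I) : ℕ → (Dual ℝ V ≃ₗ[ℝ] Dual ℝ V)
  | 0 => 1
  | k + 1 => (if Even k then R.s j else R.s i) * altProd i j k

/-- The coefficients of the image of `a_i` under an alternating product. -/
def altCoeff (a b : ℤ) : ℕ → ℤ × ℤ
  | 0 => (1, 0)
  | k + 1 => if Even k then ((altCoeff a b k).1, -(altCoeff a b k).2 + b * (altCoeff a b k).1)
      else (-(altCoeff a b k).1 + a * (altCoeff a b k).2, (altCoeff a b k).2)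

/-- The induction needs a stronger, parity-dependent inequality: with p, q the two coefficients, the
one about to be changed is at most half of what its reflection subtracts it from. The condition a b
≥ 4 carries this over to the other parity. -/
theorem altCoeff_nonneg_of_four_le {a b : ℤ} (ha : 0 ≤ a) (hb : 0 ≤ b) (h : 4 ≤ a * b) (k : ℕ) :
    0 ≤ (altCoeff a b k).1 ∧ 0 ≤ (altCoeff a b k).2 := by
  suffices H : 0 ≤ (altCoeff a b k).1 ∧ 0 ≤ (altCoeff a b k).2 ∧
      (Even k → a * (altCoeff a b k).2 ≤ 2 * (altCoeff a b k).1) ∧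
      (¬ Even k → b * (altCoeff a b k).1 ≤ 2 * (altCoeff a b k).2) from ⟨H.1, H.2.1⟩
  induction k with
  | zero => simp [altCoeff]
  | succ k ih =>
    obtain ⟨hp, hq, h1, h2⟩ := ih
    set p := (altCoeff a b k).1
    set q := (altCoeff a b k).2
    by_cases hk : Even k
    · have h1 := h1 hk
      have h3 : 2 * q ≤ b * p := by nlinarith
      have hk' : ¬ Even (k + 1) := by rwa [Nat.even_add_one, not_not]
      simp only [altCoeff, hk, if_true, hk']
      refine ⟨hp, by linarith, by simp, fun _ => by linarith⟩
    · have h2 := h2 hk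
      have h3 : 2 * p ≤ a * q := by nlinarith
      have hk' : Even (k + 1) := by rwa [Nat.even_add_one]
      simp only [altCoeff, hk, if_false, hk']
      refine ⟨by linarith, hq, fun _ => by linarith, by simp⟩

theorem altProd_mem_weylGroup (i j : I) (k : ℕ) : R.altProd i j k ∈ R.weylGroup := by
  induction k with
  | zero => exact one_mem _
  | succ k ih =>
    rw [altProd]
    split_ifs
    exacts [mul_mem (R.s_mem_weylGroup j) ih, mul_mem (R.s_mem_weylGroup i) ih]

/-- An alternating product of `k + 1` reflections ends in `s_j`. -/
theorem altProd_succ_eq (i j : I) (k : ℕ) :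
    ∃ ω : List I, ω.length = k ∧ R.altProd i j (k + 1) = R.wordProd ω * R.s j := by
  induction k with
  | zero => exact ⟨[], rfl, by simp [altProd]⟩
  | succ k ih =>
    obtain ⟨ω, h1, h2⟩ := ih
    rw [altProd, h2, ← mul_assoc]
    split_ifs
    · exact ⟨j :: ω, by simp [h1], by simp⟩
    · exact ⟨i :: ω, by simp [h1], by simp⟩

theorem s_add_apply (i j : I) (l : Dual ℝ V) (p q : ℝ) :
    R.s i (l + p • R.α i + q • R.α j) =
      l + (-p - q * A i j - l (R.h i)) • R.α i + q • R.α j := by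
  rw [s_apply]
  simp only [LinearMap.add_apply, LinearMap.smul_apply, R.pairing, R.isGCM.diag, smul_eq_mul]
  push_cast
  module

theorem s_add_apply' (i j : I) (l : Dual ℝ V) (p q : ℝ) :
    R.s j (l + p • R.α i + q • R.α j) =
      l + p • R.α i + (-q - p * A j i - l (R.h j)) • R.α j := by
  rw [add_right_comm, s_add_apply, add_right_comm]

/-- Both sides move l only inside l + span(α i, α j), so the braid relation is an identity between
two coefficients. For m = 4 and m = 6 the product of the two Cartan entries suffices, since one
entry can be eliminated by division. -/
theorem altProd_braid {i j : I} {m : ℕ}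
    (h : (m = 2 ∧ A i j = 0 ∧ A j i = 0) ∨ (m = 3 ∧ A i j = -1 ∧ A j i = -1) ∨
      (m = 4 ∧ A i j * A j i = 2) ∨ (m = 6 ∧ A i j * A j i = 3)) :
    R.altProd i j m = R.altProd j i m := by
  ext1 l
  -- The zero coefficients bring l into the shape on which `s_add_apply` and `s_add_apply'` can be
  -- iterated.
  have hl : l = l + (0 : ℝ) • R.α i + (0 : ℝ) • R.α j := by simp
  set x : ℝ := (A i j : ℝ) with hx
  set y : ℝ := (A j i : ℝ) with hy
  have key : ∀ u v u' v' : ℝ, u = u' → v = v' → l + u • R.α i + v • R.α j =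
    l + u' • R.α i + v' • R.α j := by rintro u v _ _ rfl rfl; rfl
  rcases h with ⟨rfl, h1, h2⟩ | ⟨rfl, h1, h2⟩ | ⟨rfl, h1⟩ | ⟨rfl, h1⟩
  · simp only [altProd, LinearEquiv.mul_apply, mul_one, Nat.even_add_one]
    simp only [Even.zero, if_true, not_true, if_false]
    rw [hl]
    simp only [R.s_add_apply i j, R.s_add_apply' i j, ← hx, ← hy]
    have hx0 : x = 0 := by simp [hx, h1]
    have hy0 : y = 0 := by simp [hy, h2]
    apply key <;> rw [hx0, hy0] <;> ring
  · simp only [altProd, LinearEquiv.mul_apply, mul_one, Nat.even_add_one]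
    simp only [Even.zero, if_true, not_true, if_false, not_false_iff]
    rw [hl]
    simp only [R.s_add_apply i j, R.s_add_apply' i j, ← hx, ← hy]
    have hx0 : x = -1 := by simp [hx, h1]
    have hy0 : y = -1 := by simp [hy, h2]
    apply key <;> rw [hx0, hy0] <;> ring
  · simp only [altProd, LinearEquiv.mul_apply, mul_one, Nat.even_add_one]
    simp only [Even.zero, if_true, not_true, if_false, not_false_iff]
    rw [hl]
    simp only [R.s_add_apply i j, R.s_add_apply' i j, ← hx, ← hy]
    have hxy : x * y = 2 := by rw [hx, hy]; exact_mod_cast h1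
    have hx0 : x ≠ 0 := by rintro h; simp [h] at hxy
    have hy0 : y = 2 / x := by field_simp; linarith
    apply key <;> rw [hy0] <;> field_simp <;> ring
  · simp only [altProd, LinearEquiv.mul_apply, mul_one, Nat.even_add_one]
    simp only [Even.zero, if_true, not_true, if_false, not_false_iff]
    rw [hl]
    simp only [R.s_add_apply i j, R.s_add_apply' i j, ← hx, ← hy]
    have hxy : x * y = 3 := by rw [hx, hy]; exact_mod_cast h1
    have hx0 : x ≠ 0 := by rintro h; simp [h] at hxy
    have hy0 : y = 3 / x := by field_simp; linarith
    apply key <;> rw [hy0] <;> field_simp <;> ring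

/-- An action of the Weyl group on a vector space by the formulas of the action on simple roots
or on simple coroots. -/
structure IsSimpleSystem {M : Type*} [AddCommGroup M] [Module ℝ M]
    (act : (Dual ℝ V ≃ₗ[ℝ] Dual ℝ V) →* End ℝ M) (a : I → M) (B : Matrix I I ℤ) : Prop where
  isGCM : IsGCM B
  mul_eq : ∀ i j, B i j * B j i = A i j * A j i
  act_s : ∀ i j, act (R.s i) (a j) = a j - (B i j : ℝ) • a i

/-! ### Sign-coherence of real roots and coroots -/

namespace IsSimpleSystem

variable {R} {M : Type*} [AddCommGroup M] [Module ℝ M]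
  {act : (Dual ℝ V ≃ₗ[ℝ] Dual ℝ V) →* End ℝ M} {a : I → M} {B : Matrix I I ℤ}

theorem act_s_self (H : R.IsSimpleSystem act a B) (i : I) : act (R.s i) (a i) = - a i := by
  rw [H.act_s, H.isGCM.diag]
  push_cast
  module

theorem act_altProd (H : R.IsSimpleSystem act a B) (i j : I) (k : ℕ) :
    act (R.altProd i j k) (a i) = ((altCoeff (-B i j) (-B j i) k).1 : ℝ) • a i +
      ((altCoeff (-B i j) (-B j i) k).2 : ℝ) • a j := by
  induction k with
  | zero => simp [altProd, altCoeff]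
  | succ k ih =>
    rw [altProd, altCoeff, map_mul, Module.End.mul_apply, ih]
    split_ifs
    · simp only [map_add, map_smul, H.act_s_self, H.act_s j i]
      push_cast
      module
    · simp only [map_add, map_smul, H.act_s_self, H.act_s i j]
      push_cast
      module

/-- In rank two, either all alternating products have nonnegative coefficients, or the
coefficients are nonnegative up to the length of a braid relation. -/
theorem rank_two (H : R.IsSimpleSystem act a B) {i j : I} (hij : i ≠ j) :
    (∀ k, 0 ≤ (altCoeff (-B i j) (-B j i) k).1 ∧ 0 ≤ (altCoeff (-B i j) (-B j i) k).2) ∨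
    ∃ m, (∀ k < m, 0 ≤ (altCoeff (-B i j) (-B j i) k).1 ∧
      0 ≤ (altCoeff (-B i j) (-B j i) k).2) ∧ 0 < m ∧ R.altProd i j m = R.altProd j i m := by
  have hx := H.isGCM.nonpos i j hij
  have hy := H.isGCM.nonpos j i hij.symm
  have hA := R.isGCM.nonpos i j hij
  have hA' := R.isGCM.nonpos j i hij.symm
  have hxy := H.mul_eq i j
  have hz := H.isGCM.zero_symm i j
  have hz' := H.isGCM.zero_symm j i
  have hz2 := R.isGCM.zero_symm i j
  have hz2' := R.isGCM.zero_symm j i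
  obtain ⟨x, hx'⟩ : ∃ x, x = -B i j := ⟨_, rfl⟩
  obtain ⟨y, hy'⟩ : ∃ y, y = -B j i := ⟨_, rfl⟩
  rw [← hx', ← hy']
  have hx0 : 0 ≤ x := by omega
  have hy0 : 0 ≤ y := by omega
  have hxy' : x * y = A i j * A j i := by rw [hx', hy', ← hxy]; ring
  by_cases h4 : 4 ≤ x * y
  · exact Or.inl (altCoeff_nonneg_of_four_le hx0 hy0 h4)
  right
  have hxz : x = 0 ↔ y = 0 := by
    constructor
    · intro h; have := hz (by omega); omega
    · intro h; have := hz' (by omega); omega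
  by_cases hx1 : x = 0
  · have hy1 := hxz.1 hx1
    subst hx1; subst hy1
    have : A i j = 0 := by
      have : A i j * A j i = 0 := by rw [← hxy']; rfl
      rcases mul_eq_zero.1 this with h | h
      exacts [h, hz2' h]
    refine ⟨2, fun k hk => ?_, by norm_num, R.altProd_braid (Or.inl ⟨rfl, this, hz2 this⟩)⟩
    interval_cases k <;> decide
  have hx2 : 1 ≤ x := by omega
  have hy2 : 1 ≤ y := by
    have : y ≠ 0 := fun h => hx1 (hxz.2 h)
    omega
  have hx3 : x ≤ 3 := by nlinarith
  have hy3 : y ≤ 3 := by nlinarith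
  have h11 : ∀ u v : ℤ, u ≤ 0 → v ≤ 0 → 1 = u * v → u = -1 ∧ v = -1 := by
    intro u v hu hv h
    rcases Int.eq_one_or_neg_one_of_mul_eq_one' h.symm with h | h <;> omega
  have cases5 : (x = 1 ∧ y = 1) ∨ (x * y = 2 ∧ (x = 1 ∧ y = 2 ∨ x = 2 ∧ y = 1)) ∨
      (x * y = 3 ∧ (x = 1 ∧ y = 3 ∨ x = 3 ∧ y = 1)) := by
    interval_cases x <;> interval_cases y <;> omega
  rcases cases5 with ⟨rfl, rfl⟩ | ⟨h, h'⟩ | ⟨h, h'⟩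
  · refine ⟨3, fun k hk => ?_, by norm_num,
      R.altProd_braid (Or.inr (Or.inl ⟨rfl, h11 _ _ hA hA' (by rw [← hxy']; rfl)⟩))⟩
    interval_cases k <;> decide
  · refine ⟨4, fun k hk => ?_, by norm_num,
      R.altProd_braid (Or.inr (Or.inr (Or.inl ⟨rfl, by rw [← hxy', h]⟩)))⟩
    rcases h' with ⟨rfl, rfl⟩ | ⟨rfl, rfl⟩ <;> interval_cases k <;> decide
  · refine ⟨6, fun k hk => ?_, by norm_num,
      R.altProd_braid (Or.inr (Or.inr (Or.inr ⟨rfl, by rw [← hxy', h]⟩)))⟩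
    rcases h' with ⟨rfl, rfl⟩ | ⟨rfl, rfl⟩ <;> interval_cases k <;> decide

/-- If `i` is not a right descent of `w`, then `w a_i` is a nonnegative integral combination of
the `a_j`. -/
theorem act_mem_closure (H : R.IsSimpleSystem act a B) {w : Dual ℝ V ≃ₗ[ℝ] Dual ℝ V}
    (hw : w ∈ R.weylGroup) {i : I} (hi : R.length w ≤ R.length (w * R.s i)) :
    act w (a i) ∈ AddSubmonoid.closure (Set.range a) := by
  induction hn : R.length w using Nat.strong_induction_on generalizing w i with
  | _ n ih =>
    subst hn
    by_cases h1 : w = 1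
    · rw [h1, map_one]
      exact AddSubmonoid.subset_closure ⟨i, rfl⟩
    -- Starting from a right descent j, strip s_j, s_i, s_j, … from the right of w for as long as
    -- the length drops by one each time. The element reached has neither i nor j as a right
    -- descent, and the stripped factor lies in the rank-two group.
    obtain ⟨j, hj⟩ := R.exists_length_mul_s_lt hw h1
    have hij : i ≠ j := by rintro rfl; omega
    obtain ⟨v, hvdef⟩ : ∃ v : ℕ → (Dual ℝ V ≃ₗ[ℝ] Dual ℝ V),
        ∀ k, v k = w * (R.altProd i j k)⁻¹ := ⟨_, fun _ => rfl⟩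
    have hv : ∀ k, v k ∈ R.weylGroup := fun k => by
      rw [hvdef]; exact mul_mem hw (inv_mem (R.altProd_mem_weylGroup i j k))
    have hv0 : v 0 = w := by simp [hvdef, altProd]
    have hvs : ∀ k, v (k + 1) = v k * R.s (if Even k then j else i) := by
      intro k
      simp only [hvdef, altProd, mul_inv_rev, mul_assoc]
      split_ifs <;> rw [s_inv]
    have hex : ∃ k, R.length (v k) + k ≠ R.length w := ⟨R.length w + 1, by omega⟩
    classical
    set k := Nat.find hex with hk
    have hk1 : R.length (v k) + k ≠ R.length w := Nat.find_spec hex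
    have hlt : ∀ m < k, R.length (v m) + m = R.length w := fun m hm => by
      simpa using Nat.find_min hex hm
    have hk0 : k ≠ 0 := by
      intro h
      rw [h, hv0] at hk1
      simp at hk1
    have hk10 : k ≠ 1 := by
      intro h
      rw [h, show v 1 = w * R.s j by rw [hvs 0, hv0]; simp] at hk1
      have := R.length_le_mul_s hw j
      omega
    obtain ⟨m, hm⟩ : ∃ m, k = m + 2 := ⟨k - 2, by omega⟩
    -- `v (m + 1)` is minimal in its coset with respect to `i` and `j`
    have hm0 := hlt m (by omega)
    have hm1 := hlt (m + 1) (by omega)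
    have hprev : R.length (v (m + 1)) ≤
        R.length (v (m + 1) * R.s (if Even m then j else i)) := by
      rw [hvs m, mul_assoc, s_mul_s, mul_one, ← hvs m]
      omega
    have hnext : R.length (v (m + 1)) ≤
        R.length (v (m + 1) * R.s (if Even (m + 1) then j else i)) := by
      rw [← hvs (m + 1)]
      have h2 := R.length_le_mul_s (hv (m + 1)) (if Even (m + 1) then j else i)
      rw [← hvs (m + 1)] at h2
      rw [hm] at hk1
      have h3 : m + 1 + 1 = m + 2 := rfl
      rw [h3] at h2 ⊢
      omega
    have hboth : ∀ t, (t = i ∨ t = j) →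
        act (v (m + 1)) (a t) ∈ AddSubmonoid.closure (Set.range a) := by
      intro t ht
      refine ih _ ?_ (hv _) ?_ rfl
      · omega
      · simp only [Nat.even_add_one] at hnext
        by_cases hE : Even m
        · simp only [hE, if_true, not_true, if_false] at hprev hnext
          rcases ht with rfl | rfl <;> assumption
        · simp only [hE, if_true, not_false_iff, if_false] at hprev hnext
          rcases ht with rfl | rfl <;> assumption
    have hwv : ∀ k, w = v k * R.altProd i j k := fun k => by simp [hvdef]
    have hfin : (0 ≤ (altCoeff (-B i j) (-B j i) (m + 1)).1 ∧
        0 ≤ (altCoeff (-B i j) (-B j i) (m + 1)).2) →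
        act w (a i) ∈ AddSubmonoid.closure (Set.range a) := by
      rintro ⟨hp, hq⟩
      rw [hwv (m + 1), map_mul, Module.End.mul_apply, H.act_altProd]
      obtain ⟨p, hp⟩ := Int.eq_ofNat_of_zero_le hp
      obtain ⟨q, hq⟩ := Int.eq_ofNat_of_zero_le hq
      rw [hp, hq, map_add, map_smul, map_smul]
      simp only [Int.cast_natCast, Nat.cast_smul_eq_nsmul]
      exact add_mem (nsmul_mem (hboth i (Or.inl rfl)) p) (nsmul_mem (hboth j (Or.inr rfl)) q)
    rcases H.rank_two hij with h | ⟨N, h, hN, hbraid⟩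
    · exact hfin (h _)
    · by_cases hmN : m + 1 < N
      · exact hfin (h _ hmN)
      · exfalso
        -- Here a full braid word could be stripped. Rewritten by the braid relation it ends in s_i,
        -- so w s_i would be shorter than w.
        have hN1 := hlt N (by omega)
        obtain ⟨N', rfl⟩ : ∃ N', N = N' + 1 := ⟨N - 1, by omega⟩
        obtain ⟨ω, hω, hω'⟩ := R.altProd_succ_eq j i N'
        have : w * R.s i = v (N' + 1) * R.wordProd ω := by
          conv_lhs => rw [hwv (N' + 1), hbraid, hω']
          simp [mul_assoc, s_mul_s]
        have h2 := R.length_mul_wordProd_le (hv (N' + 1)) ω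
        rw [← this] at h2
        omega

/-- If `i` is a right descent of `w`, then `w a_i` is a nonpositive integral combination of
the `a_j`. -/
theorem neg_act_mem_closure (H : R.IsSimpleSystem act a B) {w : Dual ℝ V ≃ₗ[ℝ] Dual ℝ V}
    (hw : w ∈ R.weylGroup) {i : I} (hi : R.length (w * R.s i) ≤ R.length w) :
    -act w (a i) ∈ AddSubmonoid.closure (Set.range a) := by
  have := H.act_mem_closure (mul_mem hw (R.s_mem_weylGroup i)) (i := i)
    (by rwa [mul_assoc, s_mul_s, mul_one])
  rwa [map_mul, Module.End.mul_apply, H.act_s_self, map_neg] at this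

end IsSimpleSystem

end KacMoody.Realization

namespace KacMoody.Realization

variable {I V : Type*} [AddCommGroup V] [Module ℝ V] {A : Matrix I I ℤ} (R : Realization A V)

/-! ### Roots and coroots -/

/-- The contragredient action on the dual space. -/
def coact (E : Type*) [AddCommGroup E] [Module ℝ E] : (E ≃ₗ[ℝ] E) →* End ℝ (Dual ℝ E) where
  toFun w := (w⁻¹ : E ≃ₗ[ℝ] E).toLinearMap.dualMap
  map_one' := by ext; rfl
  map_mul' u v := by ext; simp [mul_inv_rev]

/-- The tautological action on the space itself. -/
def tautAct (E : Type*) [AddCommGroup E] [Module ℝ E] : (E ≃ₗ[ℝ] E) →* End ℝ E where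
  toFun w := w.toLinearMap
  map_one' := rfl
  map_mul' _ _ := rfl

theorem isSimpleSystem_root : R.IsSimpleSystem (tautAct _) R.α A where
  isGCM := R.isGCM
  mul_eq _ _ := rfl
  act_s i j := by
    change R.s i (R.α j) = _
    rw [s_apply, R.pairing]

theorem _root_.KacMoody.IsGCM.transpose {A : Matrix I I ℤ} (h : IsGCM A) :
    IsGCM A.transpose where
  diag i := h.diag i
  nonpos i j hij := h.nonpos j i hij.symm
  zero_symm i j hij := h.zero_symm j i hij

/-- Coroots are viewed in the bidual. The matrix is transposed because s_i sends h j to h j - α i (h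
j) • h i, with α i (h j) = A j i. -/
theorem isSimpleSystem_coroot :
    R.IsSimpleSystem (coact _) (fun i => Dual.eval ℝ V (R.h i)) A.transpose where
  isGCM := R.isGCM.transpose
  mul_eq i j := mul_comm _ _
  act_s i j := by
    ext l
    change ((R.s i)⁻¹ l) (R.h j) = _
    rw [s_inv, s_apply_apply]
    simp [R.pairing, mul_comm]

variable [Fintype I] {w : Dual ℝ V ≃ₗ[ℝ] Dual ℝ V}

theorem root_nonneg (hw : w ∈ R.weylGroup) {i : I} (h : R.length w ≤ R.length (w * R.s i)) :
    ∃ n : I → ℕ, w (R.α i) = ∑ k, n k • R.α k := by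
  have := R.isSimpleSystem_root.act_mem_closure hw h
  rwa [AddSubmonoid.mem_closure_range_iff_of_fintype] at this

theorem root_nonpos (hw : w ∈ R.weylGroup) {i : I} (h : R.length (w * R.s i) ≤ R.length w) :
    ∃ n : I → ℕ, w (R.α i) = -∑ k, n k • R.α k := by
  have := R.isSimpleSystem_root.neg_act_mem_closure hw h
  rw [AddSubmonoid.mem_closure_range_iff_of_fintype] at this
  obtain ⟨n, hn⟩ := this
  exact ⟨n, by rw [← hn, neg_neg]; rfl⟩

/-- The functional l ↦ w l (h i) is the coroot w⁻¹ h i. This is why left multiplication by s_i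
governs its sign. -/
theorem coroot_nonneg (hw : w ∈ R.weylGroup) {i : I} (h : R.length w ≤ R.length (R.s i * w)) :
    ∃ n : I → ℕ, ∀ l, w l (R.h i) = ∑ k, n k * l (R.h k) := by
  have := R.isSimpleSystem_coroot.act_mem_closure (i := i) (inv_mem hw)
    (by rwa [← R.length_s_mul hw, R.length_inv hw])
  rw [AddSubmonoid.mem_closure_range_iff_of_fintype] at this
  obtain ⟨n, hn⟩ := this
  refine ⟨n, fun l => ?_⟩
  have := LinearMap.congr_fun hn l
  simpa [coact] using this

theorem coroot_nonpos (hw : w ∈ R.weylGroup) {i : I} (h : R.length (R.s i * w) ≤ R.length w) :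
    ∃ n : I → ℕ, ∀ l, w l (R.h i) = -∑ k, n k * l (R.h k) := by
  have := R.isSimpleSystem_coroot.neg_act_mem_closure (i := i) (inv_mem hw)
    (by rwa [← R.length_s_mul hw, R.length_inv hw])
  rw [AddSubmonoid.mem_closure_range_iff_of_fintype] at this
  obtain ⟨n, hn⟩ := this
  refine ⟨n, fun l => ?_⟩
  have := LinearMap.congr_fun hn l
  rw [← neg_eq_iff_eq_neg]
  simpa [coact] using this

omit [Fintype I] in
theorem exists_eval_h (c : I → ℝ) : ∃ l : Dual ℝ V, ∀ i, l (R.h i) = c i := by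
  let b := Basis.span R.linearIndependent_h
  obtain ⟨l, hl⟩ := LinearMap.exists_extend (b.constr ℝ c)
  refine ⟨l, fun i => ?_⟩
  have : l (b i) = c i := by
    rw [← b.constr_basis ℝ c i, ← hl]
    rfl
  rwa [Basis.span_apply] at this

omit [Fintype I] in
theorem exists_eval_α (c : I → ℝ) : ∃ g : Dual ℝ (Dual ℝ V), ∀ i, g (R.α i) = c i := by
  let b := Basis.span R.linearIndependent_α
  obtain ⟨l, hl⟩ := LinearMap.exists_extend (b.constr ℝ c)
  refine ⟨l, fun i => ?_⟩
  have : l (b i) = c i := by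
    rw [← b.constr_basis ℝ c i, ← hl]
    rfl
  rwa [Basis.span_apply] at this

open Classical in
omit [Fintype I] in
/-- A vector on which `h i` takes the value one and the other simple coroots vanish. -/
theorem exists_fundamental (i : I) :
    ∃ l ∈ R.closedChamber, l (R.h i) = 1 ∧ ∀ j ≠ i, l (R.h j) = 0 := by
  obtain ⟨l, hl⟩ := R.exists_eval_h (Pi.single i 1)
  refine ⟨l, fun j => ?_, by simp [hl], fun j hj => by simp [hl, hj]⟩
  rw [hl]
  rw [Pi.single_apply]
  split_ifs <;> norm_num

theorem coroot_nonneg_apply (hw : w ∈ R.weylGroup) {i : I}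
    (h : R.length w ≤ R.length (R.s i * w)) {l : Dual ℝ V} (hl : l ∈ R.closedChamber) :
    0 ≤ w l (R.h i) := by
  obtain ⟨n, hn⟩ := R.coroot_nonneg hw h
  rw [hn]
  exact Finset.sum_nonneg fun k _ => mul_nonneg (Nat.cast_nonneg _) (hl k)

theorem coroot_nonpos_apply (hw : w ∈ R.weylGroup) {i : I}
    (h : R.length (R.s i * w) ≤ R.length w) {l : Dual ℝ V} (hl : l ∈ R.closedChamber) :
    w l (R.h i) ≤ 0 := by
  obtain ⟨n, hn⟩ := R.coroot_nonpos hw h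
  rw [hn, neg_nonpos]
  exact Finset.sum_nonneg fun k _ => mul_nonneg (Nat.cast_nonneg _) (hl k)

omit [Fintype I] in
theorem exists_apply_h_ne_zero (w : Dual ℝ V ≃ₗ[ℝ] Dual ℝ V) (i : I) :
    ∃ l, w l (R.h i) = 1 := by
  obtain ⟨l, -, hl, -⟩ := R.exists_fundamental i
  exact ⟨w.symm l, by simpa⟩

theorem coeff_coroot_ne_zero {i : I} {n : I → ℕ}
    (hn : ∀ l, w l (R.h i) = ∑ k, n k * l (R.h k)) : ∃ k, n k ≠ 0 := by
  by_contra! h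
  obtain ⟨l, hl⟩ := R.exists_apply_h_ne_zero w i
  simp [hn, h] at hl

/-- A coroot which is nonnegative on the chamber is positive. -/
theorem length_lt_of_apply_nonneg (hw : w ∈ R.weylGroup) {i : I}
    (h : ∀ l ∈ R.closedChamber, 0 ≤ w l (R.h i)) : R.length w < R.length (R.s i * w) := by
  by_contra! hlt
  obtain ⟨n, hn⟩ := R.coroot_nonpos hw hlt
  have hn' : ∃ k, n k ≠ 0 := by
    by_contra! h0
    obtain ⟨l, hl⟩ := R.exists_apply_h_ne_zero w i
    simp [hn, h0] at hl
  obtain ⟨k, hk⟩ := hn'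
  obtain ⟨l, hl, hl1, hl0⟩ := R.exists_fundamental k
  have := h l hl
  rw [hn, Finset.sum_eq_single k (fun j _ hj => by rw [hl0 j hj, mul_zero]) (by simp), hl1] at this
  have : (0 : ℝ) < n k := by exact_mod_cast Nat.pos_of_ne_zero hk
  linarith

theorem apply_h_eq_sum {l : Dual ℝ V} {n : I → ℝ} {k : I} (hl1 : l (R.h k) = 1)
    (hl0 : ∀ j ≠ k, l (R.h j) = 0) : ∑ j, n j * l (R.h j) = n k := by
  rw [Finset.sum_eq_single k (fun j _ hj => by rw [hl0 j hj, mul_zero]) (by simp), hl1, mul_one]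

/-! ### Convexity of the Tits cone -/

omit [Fintype I] in
theorem closedChamber_subset_titsCone : R.closedChamber ⊆ R.titsCone :=
  fun l hl => ⟨1, one_mem _, l, hl, rfl⟩

omit [Fintype I] in
theorem apply_mem_titsCone (hw : w ∈ R.weylGroup) {l : Dual ℝ V} (hl : l ∈ R.titsCone) :
    w l ∈ R.titsCone := by
  obtain ⟨u, hu, m, hm, rfl⟩ := hl
  exact ⟨w * u, mul_mem hw hu, m, hm, rfl⟩

omit [Fintype I] in
theorem apply_mem_titsCone_iff (hw : w ∈ R.weylGroup) {l : Dual ℝ V} :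
    w l ∈ R.titsCone ↔ l ∈ R.titsCone := by
  refine ⟨fun h => ?_, R.apply_mem_titsCone hw⟩
  have := R.apply_mem_titsCone (inv_mem hw) h
  rwa [← LinearEquiv.mul_apply, inv_mul_cancel] at this

/-- A vector is in the Tits cone if the positive coroots on which it is negative are inversions
of a fixed element. -/
theorem mem_titsCone_of_inversions (hw : w ∈ R.weylGroup) {ν : Dual ℝ V}
    (h : ∀ u ∈ R.weylGroup, ∀ i, R.length u < R.length (R.s i * u) → u ν (R.h i) < 0 →
      R.length (R.s i * (u * w)) < R.length (u * w)) : ν ∈ R.titsCone := by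
  induction hn : R.length w using Nat.strong_induction_on generalizing w ν with
  | _ n ih =>
    subst hn
    by_cases hν : ν ∈ R.closedChamber
    · exact R.closedChamber_subset_titsCone hν
    obtain ⟨i, hi⟩ : ∃ i, ν (R.h i) < 0 := by simpa [closedChamber] using hν
    have h1 := h 1 (one_mem _) i (R.length_lt_of_apply_nonneg (one_mem _) fun l hl => hl i) hi
    rw [one_mul] at h1
    have hsi := R.s_mem_weylGroup i
    rw [← R.apply_mem_titsCone_iff hsi]
    refine ih _ h1 (mul_mem hsi hw) ?_ rfl
    intro u hu k hk hneg
    have key := h (u * R.s i) (mul_mem hu hsi) k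
    rw [← mul_assoc u]
    refine key ?_ hneg
    obtain ⟨n, hn⟩ := R.coroot_nonneg hu hk.le
    -- The coroot u⁻¹ h k is not a multiple of h i, because s_i ν is positive on h i. So it has a
    -- positive coefficient at some k' ≠ i, which s_i leaves unchanged: s_i permutes the positive
    -- coroots other than h i.
    have hpos : ∃ k', k' ≠ i ∧ n k' ≠ 0 := by
      by_contra! h0
      rw [hn, Finset.sum_eq_single i (fun j _ hj => by simp [h0 j hj]) (by simp),
        s_apply_apply, R.pairing, R.isGCM.diag] at hneg
      have : (0 : ℝ) ≤ n i := Nat.cast_nonneg _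
      push_cast at hneg
      nlinarith
    obtain ⟨k', hk', hnk⟩ := hpos
    by_contra! hle
    have husi := mul_mem hu hsi
    obtain ⟨l, hl, hl1, hl0⟩ := R.exists_fundamental k'
    have h3 := R.coroot_nonpos_apply husi (i := k) hle hl
    rw [LinearEquiv.mul_apply, s_apply, hl0 i hk'.symm, zero_smul, sub_zero, hn,
      R.apply_h_eq_sum (n := fun k => (n k : ℝ)) hl1 hl0] at h3
    have : (0 : ℝ) < n k' := by exact_mod_cast Nat.pos_of_ne_zero hnk
    linarith

/-- After translation one point m is dominant and the other is w' m'. A positive coroot that is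
negative on a combination must be negative on w' m', hence it comes from an inversion of w'. -/
theorem convex_titsCone : Convex ℝ R.titsCone := by
  rintro x ⟨w, hw, m, hm, rfl⟩ y hy a b ha hb hab
  rw [← R.apply_mem_titsCone_iff (inv_mem hw)] at hy ⊢
  obtain ⟨w', hw', m', hm', hy⟩ := hy
  rw [map_add, map_smul, map_smul, ← LinearEquiv.mul_apply, inv_mul_cancel, ← hy]
  refine R.mem_titsCone_of_inversions hw' ?_
  intro u hu i hi hneg
  by_contra! hle
  have h1 := R.coroot_nonneg_apply hu hi.le hm
  have h2 := R.coroot_nonneg_apply (mul_mem hu hw') hle hm'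
  rw [map_add, map_smul, map_smul, LinearMap.add_apply, LinearMap.smul_apply,
    LinearMap.smul_apply, smul_eq_mul, smul_eq_mul] at hneg
  rw [LinearEquiv.mul_apply] at h2
  have := mul_nonneg ha h1
  have := mul_nonneg hb h2
  change a * (u m) (R.h i) + b * (u (w' m')) (R.h i) < 0 at hneg
  linarith

omit [Fintype I] in
theorem smul_mem_titsCone {t : ℝ} (ht : 0 ≤ t) {l : Dual ℝ V} (hl : l ∈ R.titsCone) :
    t • l ∈ R.titsCone := by
  obtain ⟨w, hw, m, hm, rfl⟩ := hl
  exact ⟨w, hw, t • m, fun i => mul_nonneg ht (hm i), by simp⟩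

theorem add_mem_titsCone {l m : Dual ℝ V} (hl : l ∈ R.titsCone) (hm : m ∈ R.titsCone) :
    l + m ∈ R.titsCone := by
  have := R.convex_titsCone (R.smul_mem_titsCone zero_le_two hl)
    (R.smul_mem_titsCone zero_le_two hm) (a := 1 / 2) (b := 1 / 2) (by norm_num) (by norm_num)
    (by norm_num)
  simpa [smul_smul] using this

omit [Fintype I] in
theorem zero_mem_titsCone : (0 : Dual ℝ V) ∈ R.titsCone :=
  R.closedChamber_subset_titsCone fun _ => le_rfl

end KacMoody.Realization

namespace KacMoody

/-! ### The trichotomy for generalized Cartan matrices -/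

section Trichotomy

variable {J : Type*} {B : Matrix J J ℤ}

/-- Indecomposability, as a closure property. -/
def IsConnected (B : Matrix J J ℤ) : Prop :=
  ∀ S : Set J, S.Nonempty → (∀ j ∈ S, ∀ k, B j k ≠ 0 → k ∈ S) → S = Set.univ

variable [Fintype J]

theorem IsGCM.sum_mul_nonpos_of_eq_zero (hB : IsGCM B) {v : J → ℝ} (hv : ∀ i, 0 ≤ v i) {i : J}
    (hi : v i = 0) : ∑ j, (B i j : ℝ) * v j ≤ 0 := by
  refine Finset.sum_nonpos fun j _ => ?_
  by_cases hij : i = j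
  · simp [← hij, hi]
  · exact mul_nonpos_of_nonpos_of_nonneg (by exact_mod_cast hB.nonpos i j hij) (hv j)

theorem IsGCM.pos_of_mulVec_pos (hB : IsGCM B) {u : J → ℝ} (hu : ∀ i, 0 ≤ u i)
    (h : ∀ i, 0 < ∑ j, (B i j : ℝ) * u j) (i : J) : 0 < u i :=
  (hu i).lt_of_ne fun h0 => absurd (hB.sum_mul_nonpos_of_eq_zero hu h0.symm) (h i).not_ge

/-- Ville's theorem of the alternative for generalized Cartan matrices. -/
theorem IsGCM.alternative (hB : IsGCM B) :
    (∃ u : J → ℝ, (∀ i, 0 < u i) ∧ ∀ i, 0 < ∑ j, (B i j : ℝ) * u j) ∨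
    ∃ c : J → ℝ, (∀ i, 0 ≤ c i) ∧ c ≠ 0 ∧ ∀ j, ∑ i, c i * (B i j : ℝ) ≤ 0 := by
  classical
  by_cases hJ : Nonempty J
  swap
  · rw [not_nonempty_iff] at hJ
    exact Or.inl ⟨0, fun i => hJ.elim i, fun i => hJ.elim i⟩
  let O : Set (J → ℝ) := Set.pi Set.univ fun _ => Set.Ioi 0
  let T : (J → ℝ) →ₗ[ℝ] (J → ℝ) := (B.map (Int.cast : ℤ → ℝ)).mulVecLin
  have hT : ∀ u i, T u i = ∑ j, (B i j : ℝ) * u j := fun u i => rfl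
  -- Separate the open positive orthant from the image of the closed orthant under B. If they meet,
  -- a point of the intersection gives u; otherwise the negated separating functional gives c.
  let t : Set (J → ℝ) := T '' Set.Ici 0
  have hO : Convex ℝ O := convex_pi fun _ _ => convex_Ioi 0
  have hO' : IsOpen O := isOpen_set_pi Set.finite_univ fun _ _ => isOpen_Ioi
  have ht : Convex ℝ t := (convex_Ici 0).linear_image T
  by_cases hd : Disjoint O t
  · right
    obtain ⟨f, r, h1, h2⟩ := geometric_hahn_banach_open hO hO' ht hd
    have hr0 : r ≤ 0 := by simpa using h2 0 ⟨0, Set.mem_Ici.2 le_rfl, by simp⟩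
    have hO1 : ∀ a ∈ O, f a < 0 := fun a ha => (h1 a ha).trans_le hr0
    have ht1 : ∀ u : J → ℝ, 0 ≤ u → 0 ≤ f (T u) := by
      intro u hu
      by_contra! hneg
      have h3 : ∀ s : ℝ, 0 ≤ s → r ≤ s * f (T u) := fun s hs => by
        simpa using h2 (T (s • u)) ⟨s • u, smul_nonneg hs hu, rfl⟩
      -- This scale makes s * f (T u) equal to r - 1, below the bound r.
      have := h3 ((1 - r) / -f (T u)) (div_nonneg (by linarith) (by linarith))
      have h4 : (1 - r) / -f (T u) * f (T u) = -(1 - r) := by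
        have := hneg.ne
        field_simp
      linarith
    have hf : ∀ x, f x = ∑ i, f (Pi.single i 1) * x i := by
      intro x
      conv_lhs => rw [pi_eq_sum_univ' x]
      rw [map_sum]
      refine Finset.sum_congr rfl fun i _ => ?_
      rw [map_smul, smul_eq_mul, mul_comm]
    refine ⟨fun i => -f (Pi.single i 1), fun i => ?_, fun h0 => ?_, fun j => ?_⟩
    · by_contra! hneg
      -- If f (e_i) were positive, this vector would lie in the open orthant although f vanishes on
      -- it.
      have h3 := hO1 (Pi.single i (-f 1) + f (Pi.single i 1) • 1) ?_
      · rw [map_add, map_smul, show Pi.single i (-f 1) = (-f 1) • (Pi.single i 1 : J → ℝ) by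
          rw [← Pi.single_smul]; simp, map_smul, smul_eq_mul, smul_eq_mul] at h3
        linarith
      · intro j _
        have h4 := hO1 1 (fun _ _ => by simp [Set.mem_Ioi])
        have : (0 : ℝ) ≤ (Pi.single i (-f 1) : J → ℝ) j := by
          rw [Pi.single_apply]; split_ifs <;> linarith
        simp only [Set.mem_Ioi, Pi.add_apply, Pi.smul_apply, Pi.one_apply, smul_eq_mul]
        linarith
    · have h4 := hO1 1 (fun _ _ => by simp [Set.mem_Ioi])
      rw [hf] at h4
      have : ∀ i, f (Pi.single i 1) = 0 := fun i => by simpa using congrFun h0 i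
      simp [this] at h4
    · have := ht1 (Pi.single j 1) (by simp)
      rw [hf] at this
      simp only [hT, Pi.single_apply, mul_ite, mul_one, mul_zero, Finset.sum_ite_eq',
        Finset.mem_univ, if_true] at this
      simp only [neg_mul, Finset.sum_neg_distrib]
      linarith
  · left
    rw [Set.not_disjoint_iff] at hd
    obtain ⟨_, hx, u, hu, rfl⟩ := hd
    have hpos : ∀ i, 0 < ∑ j, (B i j : ℝ) * u j := fun i => hx i trivial
    exact ⟨u, hB.pos_of_mulVec_pos hu hpos, hpos⟩

/-- A minimum principle: if B v ≥ 0 and t = min (v i / u i) were negative, then v - t u ≥ 0 would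
vanish at a minimizing i, so row i of B would be nonpositive on it, while B v - t B u > 0. Hence v ≥
0, which yields injectivity; connectedness spreads any zero of v to all indices. -/
theorem IsConnected.isFiniteType [DecidableEq J] (hc : IsConnected B) (hB : IsGCM B) {u : J → ℝ}
    (hu : ∀ i, 0 < u i) (hBu : ∀ i, 0 < ∑ j, (B i j : ℝ) * u j) : IsFiniteType B := by
  have hmul : ∀ (v : J → ℝ) i, (B.map (Int.cast : ℤ → ℝ)).mulVec v i = ∑ j, (B i j : ℝ) * v j :=
    fun v i => rfl
  have hnonneg : ∀ v : J → ℝ, (∀ i, 0 ≤ ∑ j, (B i j : ℝ) * v j) → ∀ i, 0 ≤ v i := by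
    intro v hv i0
    by_contra! hneg
    obtain ⟨i, -, hi⟩ := Finset.exists_min_image Finset.univ (fun i => v i / u i) ⟨i0, by simp⟩
    set t := v i / u i with ht
    have ht0 : t < 0 := (hi i0 (by simp)).trans_lt (div_neg_of_neg_of_pos hneg (hu i0))
    have h1 := hB.sum_mul_nonpos_of_eq_zero (v := fun j => v j - t * u j) (i := i)
      (fun j => by
        have := hi j (by simp)
        rw [le_div_iff₀ (hu j)] at this
        linarith)
      (by rw [ht, div_mul_cancel₀ _ (hu i).ne', sub_self])
    have h2 : ∑ j, (B i j : ℝ) * (v j - t * u j) =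
        ∑ j, (B i j : ℝ) * v j - t * ∑ j, (B i j : ℝ) * u j := by
      rw [Finset.mul_sum, ← Finset.sum_sub_distrib]
      exact Finset.sum_congr rfl fun j _ => by ring
    rw [h2] at h1
    have := hv i
    have := mul_neg_of_neg_of_pos ht0 (hBu i)
    linarith
  refine ⟨?_, ⟨u, hu, hBu⟩, fun v hv => ?_⟩
  · intro hdet
    have hdet' : (B.map (Int.cast : ℤ → ℝ)).det = 0 := by
      have := (Int.castRingHom ℝ).map_det B
      rw [hdet, map_zero] at this
      exact this.symm
    obtain ⟨v, hv0, hv⟩ := Matrix.exists_mulVec_eq_zero_iff.2 hdet'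
    have h1 : ∀ i, ∑ j, (B i j : ℝ) * v j = 0 := fun i => by rw [← hmul, hv]; rfl
    apply hv0
    ext i
    refine le_antisymm ?_ (hnonneg v (fun i => (h1 i).ge) i)
    have := hnonneg (-v) (fun i => by simp [h1]) i
    simpa using this
  · have hv0 := hnonneg v hv
    by_cases hz : ∃ i, v i = 0
    · right
      have := hc {i | v i = 0} hz fun j hj k hjk => by
        have h1 := hv j
        rw [hmul] at h1
        have hterm : ∀ k ∈ Finset.univ, (B j k : ℝ) * v k ≤ 0 := fun k _ => by
          by_cases hjk : j = k
          · rw [← hjk, show v j = 0 from hj, mul_zero]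
          · exact mul_nonpos_of_nonpos_of_nonneg (by exact_mod_cast hB.nonpos j k hjk) (hv0 k)
        have h2 := (Finset.sum_eq_zero_iff_of_nonpos hterm).1
          (le_antisymm (Finset.sum_nonpos hterm) h1) k (by simp)
        rcases mul_eq_zero.1 h2 with h | h
        · exact absurd (by exact_mod_cast h) hjk
        · exact h
      ext i
      have hi : i ∈ {i | v i = 0} := by rw [this]; trivial
      exact hi
    · left
      push Not at hz
      exact fun i => (hv0 i).lt_of_ne (hz i).symm

/-- If c vanishes somewhere, connectedness gives a zero k of c adjacent to the support. Column k
then has slack, so c k can be raised slightly and the zero set shrinks. -/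
theorem IsConnected.exists_pos (hc : IsConnected B) (hB : IsGCM B) {c : J → ℝ}
    (hc0 : ∀ i, 0 ≤ c i) (hne : c ≠ 0) (h : ∀ j, ∑ i, c i * (B i j : ℝ) ≤ 0) :
    ∃ c : J → ℝ, (∀ i, 0 < c i) ∧ ∀ j, ∑ i, c i * (B i j : ℝ) ≤ 0 := by
  classical
  induction hn : (Finset.univ.filter fun i => c i = 0).card using Nat.strong_induction_on
    generalizing c with
  | _ n ih =>
    subst hn
    by_cases hall : ∀ i, c i ≠ 0
    · exact ⟨c, fun i => (hc0 i).lt_of_ne (hall i).symm, h⟩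
    push Not at hall
    obtain ⟨i0, hi0⟩ := hall
    have hS : ∃ j, c j ≠ 0 ∧ ∃ k, B j k ≠ 0 ∧ c k = 0 := by
      by_contra! hno
      have := hc {j | c j ≠ 0} (Function.ne_iff.1 hne) fun j hj k hjk => hno j hj k hjk
      have hi : i0 ∈ {j | c j ≠ 0} := by rw [this]; trivial
      exact hi hi0
    obtain ⟨j, hj, k, hjk, hk⟩ := hS
    have hterm : ∀ i ∈ Finset.univ, c i * (B i k : ℝ) ≤ 0 := fun i _ => by
      by_cases hik : i = k
      · rw [hik, hk, zero_mul]
      · exact mul_nonpos_of_nonneg_of_nonpos (hc0 i) (by exact_mod_cast hB.nonpos i k hik)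
    have hlt : ∑ i, c i * (B i k : ℝ) < 0 := by
      refine (Finset.sum_nonpos hterm).lt_of_ne fun h0 => ?_
      have := (Finset.sum_eq_zero_iff_of_nonpos hterm).1 h0 j (by simp)
      rcases mul_eq_zero.1 this with h | h
      · exact hj h
      · exact hjk (by exact_mod_cast h)
    -- Half the slack, because the diagonal entry is 2: column k then sums to exactly zero.
    set ε := -(∑ i, c i * (B i k : ℝ)) / 2 with hε
    have hε0 : 0 < ε := by linarith
    have hsum : ∀ m, ∑ i, (c i + Pi.single (M := fun _ => ℝ) k ε i) * (B i m : ℝ) =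
        ∑ i, c i * (B i m : ℝ) + ε * B k m := by
      intro m
      simp [add_mul, Finset.sum_add_distrib, Pi.single_apply]
    have hs0 : ∀ i, 0 ≤ Pi.single (M := fun _ => ℝ) k ε i := fun i => by
      rw [Pi.single_apply]; split_ifs <;> linarith
    refine ih _ ?_ (c := fun i => c i + Pi.single (M := fun _ => ℝ) k ε i)
      (fun i => add_nonneg (hc0 i) (hs0 i)) ?_ ?_ rfl
    · refine Finset.card_lt_card ⟨fun i hi => ?_, fun hsub => ?_⟩
      · simp only [Finset.mem_filter, Finset.mem_univ, true_and] at hi ⊢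
        linarith [hc0 i, hs0 i]
      · have := hsub (x := k) (by simp [hk])
        simp [hk] at this
        linarith
    · intro h0
      have := congrFun h0 k
      simp [hk] at this
      linarith
    · intro m
      rw [hsum]
      by_cases hkm : k = m
      · subst hkm
        rw [hB.diag]
        push_cast
        linarith
      · have : (B k m : ℝ) ≤ 0 := by exact_mod_cast hB.nonpos k m hkm
        have := mul_nonpos_of_nonneg_of_nonpos hε0.le this
        linarith [h m]

theorem IsConnected.exists_pos_of_not_isFiniteType [DecidableEq J] (hc : IsConnected B)
    (hB : IsGCM B) (h : ¬ IsFiniteType B) :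
    ∃ c : J → ℝ, (∀ i, 0 < c i) ∧ ∀ j, ∑ i, c i * (B i j : ℝ) ≤ 0 := by
  rcases hB.alternative with ⟨u, hu, hBu⟩ | ⟨c, hc0, hne, hcB⟩
  · exact absurd (hc.isFiniteType hB hu hBu) h
  · exact hc.exists_pos hB hc0 hne hcB

end Trichotomy

/-! ### Components of index sets and antidominant vectors -/

section Components

variable {I : Type*} {A : Matrix I I ℤ} {Θ : Set I} {i j k : I}

theorem IsGCM.submatrix (hA : IsGCM A) (S : Set I) :
    IsGCM (A.submatrix (Subtype.val : S → I) Subtype.val) where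
  diag i := hA.diag i
  nonpos i j hij := hA.nonpos i j fun h => hij (Subtype.ext h)
  zero_symm i j h := hA.zero_symm i j h

theorem mem_component_self (hi : i ∈ Θ) : i ∈ component A Θ i :=
  ⟨hi, hi, SimpleGraph.Reachable.refl _⟩

theorem component_subset : component A Θ i ⊆ Θ := fun _ ⟨_, hj, _⟩ => hj

theorem component_eq_of_mem (hj : j ∈ component A Θ i) :
    component A Θ j = component A Θ i := by
  obtain ⟨hi, hj, hij⟩ := hj
  ext k
  constructor
  · rintro ⟨_, hk, hjk⟩
    exact ⟨hi, hk, hij.trans hjk⟩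
  · rintro ⟨_, hk, hik⟩
    exact ⟨hj, hk, hij.symm.trans hik⟩

theorem mem_component_of_ne_zero (hj : j ∈ component A Θ i) (hk : k ∈ Θ) (h : A j k ≠ 0) :
    k ∈ component A Θ i := by
  by_cases hjk : j = k
  · rwa [← hjk]
  obtain ⟨hi, hj, hij⟩ := hj
  exact ⟨hi, hk, hij.trans (SimpleGraph.Adj.reachable ⟨hjk, Or.inl h⟩)⟩

theorem IsGCM.eq_zero_of_notMem_component (hA : IsGCM A) (hj : j ∈ component A Θ i) (hk : k ∈ Θ)
    (hk' : k ∉ component A Θ i) : A j k = 0 ∧ A k j = 0 := by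
  have : A j k = 0 := by
    by_contra h
    exact hk' (mem_component_of_ne_zero hj hk h)
  exact ⟨this, hA.zero_symm _ _ this⟩

theorem IsGCM.isConnected_component (hA : IsGCM A) :
    IsConnected (A.submatrix (Subtype.val : component A Θ i → I) Subtype.val) := by
  rintro S ⟨⟨j, hj⟩, hjS⟩ hS
  refine Set.eq_univ_of_forall ?_
  rintro ⟨k, hk⟩
  have hreach : ∃ (hj' : j ∈ Θ) (hk' : k ∈ Θ),
      ((dynkinGraph A).induce Θ).Reachable ⟨j, hj'⟩ ⟨k, hk'⟩ := by
    rw [← component_eq_of_mem hj] at hk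
    exact hk
  obtain ⟨hj', hk', ⟨p⟩⟩ := hreach
  have key : ∀ (x y : Θ) (_ : ((dynkinGraph A).induce Θ).Walk x y),
      (∃ hx : x.1 ∈ component A Θ i, (⟨x.1, hx⟩ : component A Θ i) ∈ S) →
      ∃ hy : y.1 ∈ component A Θ i, (⟨y.1, hy⟩ : component A Θ i) ∈ S := by
    intro x y p
    induction p with
    | nil => exact id
    | @cons x y z hxy _ ih =>
      rintro ⟨hx, hxS⟩
      have hne : A x.1 y.1 ≠ 0 := by
        rcases hxy.2 with h | h
        · exact h
        · exact fun h0 => h (hA.zero_symm _ _ h0)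
      exact ih ⟨mem_component_of_ne_zero hx y.2 hne, hS _ hxS _ hne⟩
  exact (key _ _ p ⟨hj, hjS⟩).2

variable [Fintype I]

theorem infPart_subset : infPart A Θ ⊆ Θ := fun _ h => h.1

theorem component_subset_infPart (hi : i ∈ infPart A Θ) : component A Θ i ⊆ infPart A Θ := by
  intro j hj
  refine ⟨component_subset hj, ?_⟩
  rw [component_eq_of_mem hj]
  exact hi.2

/-- Coefficients of a vector in the positive cone on the coroots with indices in `Θ`, on which
all simple roots are nonpositive. -/
structure IsAntidominant (A : Matrix I I ℤ) (c : I → ℝ) (Θ : Set I) : Prop where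
  pos : ∀ i ∈ Θ, 0 < c i
  eq_zero : ∀ i ∉ Θ, c i = 0
  nonpos : ∀ j, ∑ i, c i * (A i j : ℝ) ≤ 0

theorem IsAntidominant.nonneg {c : I → ℝ} (hc : IsAntidominant A c Θ) (i : I) : 0 ≤ c i := by
  by_cases hi : i ∈ Θ
  · exact (hc.pos i hi).le
  · exact (hc.eq_zero i hi).ge

open Classical in
theorem sum_subtype_mul (S : Set I) (f : I → ℝ) (c : S → ℝ) :
    ∑ i, (if h : i ∈ S then c ⟨i, h⟩ else 0) * f i = ∑ i : S, c i * f i := by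
  have h1 : ∀ i ∉ S, (if h : i ∈ S then c ⟨i, h⟩ else 0) * f i = 0 := fun i hi => by
    simp [hi]
  rw [← Finset.sum_subset (Finset.subset_univ S.toFinset) (fun i _ hi => h1 i (by simpa using hi)),
    ← Finset.sum_coe_sort]
  refine Fintype.sum_equiv (Equiv.subtypeEquivRight (by simp)) _ _ ?_
  rintro ⟨i, hi⟩
  have hi' : i ∈ S := by simpa using hi
  simp only [hi', dif_pos]
  rfl

/-- Components of non-finite type support antidominant vectors. -/
theorem IsGCM.exists_isAntidominant_component (hA : IsGCM A) (hi : i ∈ infPart A Θ) :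
    ∃ c, IsAntidominant A c (component A Θ i) := by
  classical
  have hfin := hi.2
  obtain ⟨c, hc, hc'⟩ := IsConnected.exists_pos_of_not_isFiniteType
    hA.isConnected_component (hA.submatrix _) hfin
  refine ⟨fun k => if h : k ∈ component A Θ i then c ⟨k, h⟩ else 0, fun k hk => ?_,
    fun k hk => by simp [hk], fun j => ?_⟩
  · simp [hk, hc]
  · by_cases hj : j ∈ component A Θ i
    · rw [sum_subtype_mul]
      refine le_of_eq_of_le ?_ (hc' ⟨j, hj⟩)
      congr!
    · refine Finset.sum_nonpos fun k _ => ?_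
      split_ifs with hk
      · refine mul_nonpos_of_nonneg_of_nonpos (hc _).le ?_
        exact_mod_cast hA.nonpos k j fun h => hj (h ▸ hk)
      · simp

/-- The non-finite part of an index set supports an antidominant vector. -/
theorem IsGCM.exists_isAntidominant_infPart (hA : IsGCM A) (Θ : Set I) :
    ∃ c, IsAntidominant A c (infPart A Θ) := by
  classical
  have h : ∀ i, ∃ c, i ∈ infPart A Θ → IsAntidominant A c (component A Θ i) := fun i => by
    by_cases hi : i ∈ infPart A Θ
    · obtain ⟨c, hc⟩ := hA.exists_isAntidominant_component hi
      exact ⟨c, fun _ => hc⟩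
    · exact ⟨0, fun h => absurd h hi⟩
  choose c hc using h
  have hnn : ∀ i, i ∈ (infPart A Θ).toFinset → ∀ k, 0 ≤ c i k := fun i hi =>
    (hc i (by simpa using hi)).nonneg
  refine ⟨fun k => ∑ i ∈ (infPart A Θ).toFinset, c i k, fun k hk => ?_, fun k hk => ?_,
    fun j => ?_⟩
  · refine Finset.sum_pos' (fun i hi => hnn i hi k) ⟨k, by simpa using hk, ?_⟩
    exact (hc k hk).pos k (mem_component_self hk.1)
  · refine Finset.sum_eq_zero fun i hi => ?_
    have hi' : i ∈ infPart A Θ := by simpa using hi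
    exact (hc i hi').eq_zero k fun h => hk (component_subset_infPart hi' h)
  · simp only [Finset.sum_mul]
    rw [Finset.sum_comm]
    exact Finset.sum_nonpos fun i hi => (hc i (by simpa using hi)).nonpos j

theorem IsGCM.exists_isAntidominant (hA : IsGCM A) (hΘ : IsSpecial A Θ) :
    ∃ c, IsAntidominant A c Θ := by
  have := hA.exists_isAntidominant_infPart Θ
  rwa [← hΘ] at this

/-- The support of an antidominant vector is special. -/
theorem IsAntidominant.isSpecial {c : I → ℝ} (hc : IsAntidominant A c Θ) (hA : IsGCM A) :
    IsSpecial A Θ := by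
  classical
  refine Set.Subset.antisymm (fun i hi => ⟨hi, ?_⟩) infPart_subset
  rintro ⟨-, ⟨u, hu, hAu⟩, -⟩
  have h1 : ∀ k : component A Θ i, 0 < ∑ j : component A Θ i, (A k j : ℝ) * u j := fun k => by
    refine (hAu k).trans_eq ?_
    simp only [Matrix.mulVec, dotProduct]
    congr!
  have hne : Nonempty (component A Θ i) := ⟨⟨i, mem_component_self hi⟩⟩
  -- On a component of finite type the number cᵀ A u would be positive because A u > 0, yet
  -- nonpositive because cᵀ A ≤ 0. Restricting c to the component is harmless, as distinct
  -- components do not interact.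
  have h2 : 0 < ∑ k : component A Θ i, c k * ∑ j : component A Θ i, (A k j : ℝ) * u j :=
    Finset.sum_pos (fun k _ => mul_pos (hc.pos k (component_subset k.2)) (h1 k))
      Finset.univ_nonempty
  have h3 : ∀ j : component A Θ i, ∑ k : component A Θ i, c k * (A k j : ℝ) ≤ 0 := fun j => by
    refine le_of_eq_of_le ?_ (hc.nonpos j)
    rw [← sum_subtype_mul (component A Θ i) (fun k => (A k j : ℝ)) (fun k => c k)]
    refine Finset.sum_congr rfl fun k _ => ?_
    split_ifs with hk
    · rfl
    · by_cases hkΘ : k ∈ Θ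
      · rw [(hA.eq_zero_of_notMem_component j.2 hkΘ hk).2]
        simp
      · rw [hc.eq_zero k hkΘ]
  have h4 : ∑ k : component A Θ i, c k * ∑ j : component A Θ i, (A k j : ℝ) * u j =
      ∑ j : component A Θ i, u j * ∑ k : component A Θ i, c k * (A k j : ℝ) := by
    simp only [Finset.mul_sum]
    rw [Finset.sum_comm]
    exact Finset.sum_congr rfl fun j _ => Finset.sum_congr rfl fun k _ => by ring
  rw [h4] at h2
  exact h2.not_ge (Finset.sum_nonpos fun j _ =>
    mul_nonpos_of_nonneg_of_nonpos (hu j).le (h3 j))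

theorem IsGCM.isSpecial_infPart (hA : IsGCM A) (Θ : Set I) : IsSpecial A (infPart A Θ) :=
  (hA.exists_isAntidominant_infPart Θ).choose_spec.isSpecial hA

/-- The complement of the non-finite part satisfies the positivity condition of finite type. -/
theorem IsGCM.exists_pos_diff_infPart (hA : IsGCM A) (Θ : Set I) :
    ∃ u : I → ℝ, (∀ i ∈ Θ \ infPart A Θ, 0 < u i) ∧ (∀ i ∉ Θ \ infPart A Θ, u i = 0) ∧
      ∀ i ∈ Θ \ infPart A Θ, 0 < ∑ j, u j * (A i j : ℝ) := by
  classical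
  set J := Θ \ infPart A Θ with hJ
  have hcomp : ∀ i ∈ J, component A Θ i ⊆ J := fun i hi k hk =>
    ⟨component_subset hk, fun hk' => hi.2
      (component_subset_infPart hk' (by
        rw [component_eq_of_mem hk]; exact mem_component_self hi.1))⟩
  have h : ∀ i, ∃ u : I → ℝ, i ∈ J → (∀ k ∈ component A Θ i, 0 < u k) ∧
      (∀ k ∉ component A Θ i, u k = 0) ∧
      ∀ k ∈ component A Θ i, 0 < ∑ j, u j * (A k j : ℝ) := fun i => by
    by_cases hi : i ∈ J
    · have hfin : IsFiniteType (A.submatrix (Subtype.val : component A Θ i → I) Subtype.val) := by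
        by_contra hcon
        exact hi.2 ⟨hi.1, by convert hcon⟩
      obtain ⟨-, ⟨u, hu, hAu⟩, -⟩ := hfin
      refine ⟨fun k => if h : k ∈ component A Θ i then u ⟨k, h⟩ else 0, fun _ => ⟨fun k hk => ?_,
        fun k hk => by simp [hk], fun k hk => ?_⟩⟩
      · simp [hk, hu]
      · rw [sum_subtype_mul]
        refine (hAu ⟨k, hk⟩).trans_eq ?_
        exact Finset.sum_congr rfl fun j _ => mul_comm _ _
    · exact ⟨0, fun h => absurd h hi⟩
  choose u hu using h
  have hnn : ∀ i, i ∈ J.toFinset → ∀ k, 0 ≤ u i k := fun i hi k => by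
    obtain ⟨h1, h2, -⟩ := hu i (by simpa using hi)
    by_cases hk : k ∈ component A Θ i
    exacts [(h1 k hk).le, (h2 k hk).ge]
  refine ⟨fun k => ∑ i ∈ J.toFinset, u i k, fun k hk => ?_, fun k hk => ?_, fun k hk => ?_⟩
  · refine Finset.sum_pos' (fun i hi => hnn i hi k) ⟨k, by simpa using hk, ?_⟩
    exact (hu k hk).1 k (mem_component_self hk.1)
  · refine Finset.sum_eq_zero fun i hi => ?_
    have hi' : i ∈ J := by simpa using hi
    exact (hu i hi').2.1 k fun h => hk (hcomp i hi' h)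
  · simp only [Finset.sum_mul]
    rw [Finset.sum_comm]
    refine Finset.sum_pos' (fun i hi => ?_) ⟨k, by simpa using hk, ?_⟩
    · have hi' : i ∈ J := by simpa using hi
      by_cases hk' : k ∈ component A Θ i
      · exact ((hu i hi').2.2 k hk').le
      · refine (Finset.sum_eq_zero fun j _ => ?_).ge
        by_cases hj : j ∈ component A Θ i
        · rw [(hA.eq_zero_of_notMem_component hj hk.1 hk').2]
          simp
        · rw [(hu i hi').2.1 j hj, zero_mul]
    · exact (hu k hk).2.2 k (mem_component_self hk.1)

theorem IsGCM.diff_infPart_subset_perp (hA : IsGCM A) (Θ : Set I) :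
    Θ \ infPart A Θ ⊆ perp A (infPart A Θ) := by
  rintro i ⟨hi, hi'⟩ j hj
  by_contra h
  have h' : A j i ≠ 0 := fun h0 => h (hA.zero_symm _ _ h0)
  exact hi' (component_subset_infPart hj
    (mem_component_of_ne_zero (mem_component_self hj.1) hi h'))

end Components

end KacMoody

namespace KacMoody.Realization

variable {I V : Type*} [AddCommGroup V] [Module ℝ V] {A : Matrix I I ℤ} (R : Realization A V)
  {Θ J K : Set I} {i j : I} {w : Dual ℝ V ≃ₗ[ℝ] Dual ℝ V} {l : Dual ℝ V}

/-! ### Special faces -/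

theorem closedFacet_subset_closedChamber : R.closedFacet Θ ⊆ R.closedChamber := fun l hl i => by
  by_cases hi : i ∈ Θ
  exacts [(hl.1 i hi).ge, hl.2 i hi]

theorem specialFace_subset_titsCone : R.specialFace Θ ⊆ R.titsCone := by
  rintro _ ⟨w, hw, m, hm, rfl⟩
  exact ⟨w, R.parabolic_le_weylGroup _ hw, m, R.closedFacet_subset_closedChamber hm, rfl⟩

/-- Elements of a parabolic subgroup do not change the values on a vector annihilated by the
simple roots of the parabolic subgroup. -/
theorem apply_apply_of_mem_parabolic (hw : w ∈ R.parabolic J) {v : V}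
    (hv : ∀ j ∈ J, R.α j v = 0) (l : Dual ℝ V) : w l v = l v := by
  induction hw using Subgroup.closure_induction generalizing l with
  | mem x hx =>
    obtain ⟨j, hj, rfl⟩ := hx
    rw [s_apply_apply, hv j hj, mul_zero, sub_zero]
  | one => rfl
  | mul x y _ _ hx hy => rw [LinearEquiv.mul_apply, hx, hy]
  | inv x _ hx => rw [← hx (x⁻¹ l), ← LinearEquiv.mul_apply, mul_inv_cancel]; rfl

/-- Elements of a parabolic subgroup fix the vectors on which its simple coroots vanish. -/
theorem apply_of_mem_parabolic (hw : w ∈ R.parabolic J) (hl : ∀ j ∈ J, l (R.h j) = 0) :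
    w l = l := by
  induction hw using Subgroup.closure_induction with
  | mem x hx =>
    obtain ⟨j, hj, rfl⟩ := hx
    rw [s_apply, hl j hj, zero_smul, sub_zero]
  | one => rfl
  | mul x y _ _ hx hy => rw [LinearEquiv.mul_apply, hy, hx]
  | inv x _ hx =>
    conv_lhs => rw [← hx]
    rw [← LinearEquiv.mul_apply, inv_mul_cancel]
    rfl

theorem apply_h_of_mem_perp (hw : w ∈ R.parabolic (perp A Θ)) (hi : i ∈ Θ) (l : Dual ℝ V) :
    w l (R.h i) = l (R.h i) :=
  R.apply_apply_of_mem_parabolic hw (fun j hj => by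
    rw [R.pairing, R.isGCM.zero_symm _ _ (hj i hi), Int.cast_zero]) l

theorem apply_h_of_mem_specialFace (hl : l ∈ R.specialFace Θ) (hi : i ∈ Θ) : l (R.h i) = 0 := by
  obtain ⟨w, hw, m, hm, rfl⟩ := hl
  rw [R.apply_h_of_mem_perp hw hi, hm.1 i hi]

theorem s_apply_mem_specialFace (hi : i ∈ Θ ∪ perp A Θ) (hl : l ∈ R.specialFace Θ) :
    R.s i l ∈ R.specialFace Θ := by
  rcases hi with hi | hi
  · rwa [s_apply, R.apply_h_of_mem_specialFace hl hi, zero_smul, sub_zero]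
  · obtain ⟨w, hw, m, hm, rfl⟩ := hl
    exact ⟨R.s i * w, mul_mem (R.s_mem_parabolic hi) hw, m, hm, rfl⟩

variable [Fintype I] {c : I → ℝ}

/-- The combination of the simple coroots with given coefficients. -/
def coVec (c : I → ℝ) : V := ∑ i, c i • R.h i

theorem apply_coVec (c : I → ℝ) (l : Dual ℝ V) : l (R.coVec c) = ∑ i, c i * l (R.h i) := by
  simp [coVec]

theorem α_coVec (c : I → ℝ) (j : I) : R.α j (R.coVec c) = ∑ i, c i * (A i j : ℝ) := by
  simp [apply_coVec, R.pairing]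

/-- Each length-increasing left factor s_i adds -(w l)(h i) * α i v ≥ 0. -/
theorem le_apply_of_antidominant {v : V} (hv : ∀ j, R.α j v ≤ 0) (hl : l ∈ R.closedChamber)
    (hw : w ∈ R.weylGroup) : l v ≤ w l v := by
  refine R.weylGroup_induction_left (p := fun w => l v ≤ w l v) le_rfl ?_ hw
  intro w i hw hlt ih
  rw [LinearEquiv.mul_apply, s_apply_apply]
  have := mul_nonpos_of_nonneg_of_nonpos (R.coroot_nonneg_apply hw hlt.le hl) (hv i)
  linarith

theorem _root_.KacMoody.IsAntidominant.α_nonpos (hc : IsAntidominant A c Θ) (j : I) :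
    R.α j (R.coVec c) ≤ 0 := by
  rw [α_coVec]
  exact hc.nonpos j

theorem _root_.KacMoody.IsAntidominant.α_neg (hc : IsAntidominant A c Θ)
    (hj : j ∉ Θ ∪ perp A Θ) : R.α j (R.coVec c) < 0 := by
  rw [α_coVec]
  simp only [Set.mem_union, not_or, perp, Set.mem_ofPred_eq, not_forall] at hj
  obtain ⟨hj, i, hi, hij⟩ := hj
  refine Finset.sum_neg' (fun k _ => ?_) ⟨i, by simp, ?_⟩
  · by_cases hk : k ∈ Θ
    · refine mul_nonpos_of_nonneg_of_nonpos (hc.nonneg k) ?_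
      exact_mod_cast R.isGCM.nonpos k j fun h => hj (h ▸ hk)
    · rw [hc.eq_zero k hk, zero_mul]
  · refine mul_neg_of_pos_of_neg (hc.pos i hi) ?_
    have h1 := R.isGCM.nonpos i j fun h => hj (h ▸ hi)
    have h2 : A i j ≠ 0 := fun h0 => hij (R.isGCM.zero_symm _ _ h0)
    exact_mod_cast h1.lt_of_ne h2

theorem _root_.KacMoody.IsAntidominant.apply_nonneg_of_mem_closedChamber
    (hc : IsAntidominant A c Θ) (hl : l ∈ R.closedChamber) : 0 ≤ l (R.coVec c) := by
  rw [apply_coVec]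
  exact Finset.sum_nonneg fun i _ => mul_nonneg (hc.nonneg i) (hl i)

theorem _root_.KacMoody.IsAntidominant.apply_nonneg (hc : IsAntidominant A c Θ)
    (hl : l ∈ R.titsCone) : 0 ≤ l (R.coVec c) := by
  obtain ⟨w, hw, m, hm, rfl⟩ := hl
  exact (hc.apply_nonneg_of_mem_closedChamber R hm).trans
    (R.le_apply_of_antidominant (hc.α_nonpos R) hm hw)

theorem _root_.KacMoody.IsAntidominant.apply_h_eq_zero (hc : IsAntidominant A c Θ)
    (hl : l ∈ R.closedChamber) (h : l (R.coVec c) = 0) (hi : i ∈ Θ) : l (R.h i) = 0 := by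
  rw [apply_coVec, Finset.sum_eq_zero_iff_of_nonneg fun i _ =>
    mul_nonneg (hc.nonneg i) (hl i)] at h
  exact (mul_eq_zero.1 (h i (by simp))).resolve_left (hc.pos i hi).ne'

theorem _root_.KacMoody.IsAntidominant.apply_eq_zero (hc : IsAntidominant A c Θ)
    (hl : ∀ i ∈ Θ, l (R.h i) = 0) : l (R.coVec c) = 0 := by
  rw [apply_coVec]
  refine Finset.sum_eq_zero fun i _ => ?_
  by_cases hi : i ∈ Θ
  · rw [hl i hi, mul_zero]
  · rw [hc.eq_zero i hi, zero_mul]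

/-- A special face is exposed by an antidominant vector. -/
theorem _root_.KacMoody.IsAntidominant.mem_specialFace_iff (hc : IsAntidominant A c Θ) :
    l ∈ R.specialFace Θ ↔ l ∈ R.titsCone ∧ l (R.coVec c) = 0 := by
  constructor
  · intro hl
    exact ⟨R.specialFace_subset_titsCone hl,
      hc.apply_eq_zero R fun i hi => R.apply_h_of_mem_specialFace hl hi⟩
  · rintro ⟨⟨w, hw, m, hm, rfl⟩, h⟩
    revert h
    refine R.weylGroup_induction_left
      (p := fun w => w m (R.coVec c) = 0 → w m ∈ R.specialFace Θ) ?_ ?_ hw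
    · intro h
      exact ⟨1, one_mem _, m, ⟨fun i hi => hc.apply_h_eq_zero R hm h hi, fun i _ => hm i⟩, rfl⟩
    · intro w i hw hlt ih h
      rw [LinearEquiv.mul_apply, s_apply_apply] at h
      -- The value zero is a sum of two nonnegative terms, so both vanish. Then either s_i preserves
      -- the face, or α i is strictly negative on the vector and s_i fixes w m.
      have h1 := R.coroot_nonneg_apply hw hlt.le hm
      have h2 := mul_nonpos_of_nonneg_of_nonpos h1 (hc.α_nonpos R i)
      have h3 := hc.apply_nonneg R (R.apply_mem_titsCone hw (R.closedChamber_subset_titsCone hm))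
      have h4 := ih (by linarith)
      rw [LinearEquiv.mul_apply]
      by_cases hi : i ∈ Θ ∪ perp A Θ
      · exact R.s_apply_mem_specialFace hi h4
      · have h5 : w m (R.h i) = 0 := by
          have : w m (R.h i) * R.α i (R.coVec c) = 0 := by linarith
          exact (mul_eq_zero.1 this).resolve_right (hc.α_neg R hi).ne
        rwa [s_apply, h5, zero_smul, sub_zero]

theorem isFace_of_exposed {F : Set (Dual ℝ V)} {v : V} (hv : ∀ l ∈ R.titsCone, 0 ≤ l v)
    (hF : ∀ l, l ∈ F ↔ l ∈ R.titsCone ∧ l v = 0) : R.IsFace F := by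
  refine ⟨⟨0, (hF 0).2 ⟨R.zero_mem_titsCone, rfl⟩⟩, ?_, fun l hl => ((hF l).1 hl).1, ?_⟩
  · intro x hx y hy a b ha hb hab
    rw [hF] at hx hy ⊢
    exact ⟨R.convex_titsCone hx.1 hy.1 ha hb hab, by simp [hx.2, hy.2]⟩
  · rintro x hx y hy z hz ⟨a, b, ha, hb, hab, rfl⟩
    rw [hF] at hz ⊢
    refine ⟨hx, ?_⟩
    have h1 := hz.2
    rw [LinearMap.add_apply, LinearMap.smul_apply, LinearMap.smul_apply, smul_eq_mul,
      smul_eq_mul] at h1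
    have h2 := mul_nonneg ha.le (hv x hx)
    have h3 := mul_nonneg hb.le (hv y hy)
    exact (mul_eq_zero.1 (by linarith : a * x v = 0)).resolve_left ha.ne'

theorem isFace_specialFace (hΘ : IsSpecial A Θ) : R.IsFace (R.specialFace Θ) := by
  obtain ⟨c, hc⟩ := R.isGCM.exists_isAntidominant hΘ
  exact R.isFace_of_exposed (fun l hl => hc.apply_nonneg R hl)
    fun l => hc.mem_specialFace_iff R

omit [Fintype I] in
theorem IsFace.image {F : Set (Dual ℝ V)} (hF : R.IsFace F) (hw : w ∈ R.weylGroup) :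
    R.IsFace (w '' F) := by
  refine ⟨hF.1.image _, hF.2.1.linear_image w.toLinearMap, ?_, ?_⟩
  · rintro _ ⟨x, hx, rfl⟩
    exact R.apply_mem_titsCone hw (hF.2.2.1 hx)
  · rintro x hx y hy _ ⟨z, hz, rfl⟩ ⟨a, b, ha, hb, hab, h⟩
    have hw' := inv_mem hw
    have hinv : ∀ u, w (w⁻¹ u) = u := fun u => by
      rw [← LinearEquiv.mul_apply, mul_inv_cancel]; rfl
    refine ⟨w⁻¹ x, hF.2.2.2 (R.apply_mem_titsCone hw' hx) (R.apply_mem_titsCone hw' hy) hz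
      ⟨a, b, ha, hb, hab, w.injective ?_⟩, hinv x⟩
    rw [map_add, map_smul, map_smul, hinv, hinv, h]

omit [Fintype I] in
theorem specialFace_anti (h : J ⊆ K) : R.specialFace K ⊆ R.specialFace J := by
  rintro _ ⟨w, hw, m, hm, rfl⟩
  refine ⟨w, R.parabolic_mono (fun i (hi : ∀ j ∈ K, A i j = 0) j hj => hi j (h hj)) hw, m,
    ⟨fun i hi => hm.1 i (h hi), fun i _ => R.closedFacet_subset_closedChamber hm i⟩, rfl⟩

end KacMoody.Realization

namespace KacMoody.Realization

variable {I V : Type*} [AddCommGroup V] [Module ℝ V] {A : Matrix I I ℤ} (R : Realization A V)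
  {Θ J K S T : Set I} {i j : I} {w : Dual ℝ V ≃ₗ[ℝ] Dual ℝ V} {l : Dual ℝ V}

/-! ### Intersections of translated special faces -/

theorem inv_apply_self (w : Dual ℝ V ≃ₗ[ℝ] Dual ℝ V) (l : Dual ℝ V) : w⁻¹ (w l) = l := by
  rw [← LinearEquiv.mul_apply, inv_mul_cancel]
  rfl

theorem apply_inv_self (w : Dual ℝ V ≃ₗ[ℝ] Dual ℝ V) (l : Dual ℝ V) : w (w⁻¹ l) = l := by
  rw [← LinearEquiv.mul_apply, mul_inv_cancel]
  rfl

theorem mem_parabolic_red (hw : w ∈ R.weylGroup) : w ∈ R.parabolic (R.red w) := by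
  obtain ⟨ω, h1, h2⟩ := R.exists_reduced hw
  have : ∀ i ∈ ω, i ∈ R.red w := fun i hi => ⟨ω, h1, h2, hi⟩
  have := R.wordProd_mem_parabolic this
  rwa [h1] at this

theorem exists_length_s_mul_lt (hw : w ∈ R.weylGroup) (h : w ≠ 1) :
    ∃ i, R.length (R.s i * w) < R.length w := by
  obtain ⟨i, hi⟩ := R.exists_length_mul_s_lt (inv_mem hw) (inv_ne_one.2 h)
  exact ⟨i, by rwa [R.length_s_mul hw, ← R.length_inv hw]⟩

theorem length_le_s_mul (hw : w ∈ R.weylGroup) (i : I) :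
    R.length w ≤ R.length (R.s i * w) + 1 := by
  rw [R.length_s_mul hw, ← R.length_inv hw]
  exact R.length_le_mul_s (inv_mem hw) i

open Classical in
theorem exists_generic (S : Set I) :
    ∃ l ∈ R.closedChamber, (∀ i ∈ S, l (R.h i) = 0) ∧ ∀ i ∉ S, l (R.h i) = 1 := by
  obtain ⟨l, hl⟩ := R.exists_eval_h fun i => if i ∈ S then 0 else 1
  refine ⟨l, fun i => ?_, fun i hi => by simp [hl, hi], fun i hi => by simp [hl, hi]⟩
  rw [hl]
  split_ifs <;> norm_num

variable [Fintype I] {c : I → ℝ}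

/-- If the first letter j of a reduced word were outside S, then w would fix the fundamental weight
of j, which is positive on h j. But j is a left descent of w, so that value has to be nonpositive.
-/
theorem red_subset_of_mem_parabolic (hw : w ∈ R.parabolic S) : R.red w ⊆ S := by
  rintro i ⟨ω, rfl, h, hi⟩
  induction ω with
  | nil => simp at hi
  | cons j ω ih =>
    have hω := R.length_wordProd_le ω
    have hj : j ∈ S := by
      by_contra hj
      obtain ⟨n, hn⟩ := R.coroot_nonpos (R.wordProd_mem_weylGroup (j :: ω)) (i := j) (by
        rw [← h, wordProd_cons, ← mul_assoc, s_mul_s, one_mul, List.length_cons]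
        omega)
      obtain ⟨l, hl, hl1, hl0⟩ := R.exists_fundamental j
      have h1 := hn l
      rw [R.apply_of_mem_parabolic hw (fun k hk => hl0 k fun h => hj (h ▸ hk)), hl1,
        R.apply_h_eq_sum (n := fun k => (n k : ℝ)) hl1 hl0] at h1
      have : (0 : ℝ) ≤ n j := Nat.cast_nonneg _
      linarith
    have hw' : R.wordProd ω ∈ R.parabolic S := by
      have := mul_mem (R.s_mem_parabolic hj) hw
      rwa [wordProd_cons, ← mul_assoc, s_mul_s, one_mul] at this
    have hred : ω.length = R.length (R.wordProd ω) := by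
      have := R.length_le_s_mul (R.wordProd_mem_weylGroup (j :: ω)) j
      rw [← h, wordProd_cons, ← mul_assoc, s_mul_s, one_mul, List.length_cons] at this
      omega
    rcases List.mem_cons.1 hi with rfl | hi
    · exact hj
    · exact ih hw' hred hi

/-- If `w l` lies on the face exposed by an antidominant vector and `w` has no left descent among
the simple roots orthogonal to that vector, then `w` fixes `l`. -/
theorem mem_parabolic_of_apply_eq_zero {v : V} (hv : ∀ j, R.α j v ≤ 0)
    (hT : ∀ j ∉ T, R.α j v < 0) (hv0 : ∀ m ∈ R.closedChamber, 0 ≤ m v) (hl : l ∈ R.closedChamber)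
    (hw : w ∈ R.weylGroup) (hwT : ∀ k ∈ T, R.length w ≤ R.length (R.s k * w))
    (h : w l v = 0) : w ∈ R.parabolic {j | l (R.h j) = 0} := by
  induction hn : R.length w using Nat.strong_induction_on generalizing w with
  | _ n ih =>
    subst hn
    -- Strip right descents j with l (h j) = 0; they do not change w l. Once none is left, w has to
    -- be 1.
    by_cases hS : ∃ j, l (R.h j) = 0 ∧ R.length (w * R.s j) < R.length w
    · obtain ⟨j, hj, hlt⟩ := hS
      have hmem : R.s j ∈ R.parabolic {j | l (R.h j) = 0} := R.s_mem_parabolic hj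
      have hw' := mul_mem hw (R.s_mem_weylGroup j)
      have := mul_mem (ih _ hlt hw' (fun k hk => ?_) ?_ rfl) hmem
      · rwa [mul_assoc, s_mul_s, mul_one] at this
      · by_contra! hcon
        have h1 := R.length_le_mul_s (mul_mem (R.s_mem_weylGroup k) hw) j
        have h2 := hwT k hk
        rw [mul_assoc] at h1
        omega
      · rwa [LinearEquiv.mul_apply, s_apply, hj, zero_smul, sub_zero]
    · push Not at hS
      by_cases h1 : w = 1
      · rw [h1]; exact one_mem _
      exfalso
      obtain ⟨i, hi⟩ := R.exists_length_s_mul_lt hw h1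
      have hiT : i ∉ T := fun hiT => absurd (hwT i hiT) hi.not_ge
      have hw' := mul_mem (R.s_mem_weylGroup i) hw
      have hww : w = R.s i * (R.s i * w) := by rw [← mul_assoc, s_mul_s, one_mul]
      have hlen : R.length (R.s i * w) ≤ R.length (R.s i * (R.s i * w)) := by
        rw [← hww]; exact hi.le
      obtain ⟨n, hn⟩ := R.coroot_nonneg hw' hlen
      have h2 := R.coroot_nonneg_apply hw' hlen hl
      have h3 := (hv0 l hl).trans (R.le_apply_of_antidominant hv hl hw')
      rw [hww, LinearEquiv.mul_apply, s_apply_apply] at h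
      have h4 := mul_nonpos_of_nonneg_of_nonpos h2 (hv i)
      have h5 : (R.s i * w) l (R.h i) = 0 :=
        (mul_eq_zero.1 (by linarith : (R.s i * w) l (R.h i) * R.α i v = 0)).resolve_right
          (hT i hiT).ne
      rw [hn, Finset.sum_eq_zero_iff_of_nonneg
        fun k _ => mul_nonneg (Nat.cast_nonneg _) (hl k)] at h5
      -- The coroot (s_i w)⁻¹ h i is now supported on indices k with l (h k) = 0, whose coroots w
      -- keeps positive. So w maps it to a nonnegative combination of simple coroots, whereas it
      -- should be -h i; evaluation at m gives the contradiction.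
      obtain ⟨m, hm, hm1, -⟩ := R.exists_fundamental i
      have h6 := hn (w⁻¹ m)
      rw [LinearEquiv.mul_apply, apply_inv_self, s_apply_apply, hm1, R.pairing,
        R.isGCM.diag] at h6
      have h7 : 0 ≤ ∑ k, n k * w⁻¹ m (R.h k) := Finset.sum_nonneg fun k _ => by
        rcases mul_eq_zero.1 (h5 k (by simp)) with h | h
        · rw [h, zero_mul]
        · refine mul_nonneg (Nat.cast_nonneg _) (R.coroot_nonneg_apply (inv_mem hw) ?_ hm)
          rw [R.length_s_mul (inv_mem hw), inv_inv, R.length_inv hw]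
          exact hS k h
      rw [← h6] at h7
      norm_num at h7

/-- In terms of vectors, w⁻¹ v - v is a nonnegative combination of coroots: every length-increasing
step adds -α i v times a positive coroot. -/
theorem exists_apply_eq_add {v : V} (hv : ∀ j, R.α j v ≤ 0) (hw : w ∈ R.weylGroup) :
    ∃ d : I → ℝ, (∀ k, 0 ≤ d k) ∧ ∀ l, w l v = l v + ∑ k, d k * l (R.h k) := by
  refine R.weylGroup_induction_left (p := fun w => ∃ d : I → ℝ, (∀ k, 0 ≤ d k) ∧
    ∀ l, w l v = l v + ∑ k, d k * l (R.h k)) ⟨0, fun _ => le_rfl, by simp⟩ ?_ hw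
  rintro w i hw hlt ⟨d, hd, h⟩
  obtain ⟨n, hn⟩ := R.coroot_nonneg hw hlt.le
  refine ⟨fun k => d k + -R.α i v * n k, fun k =>
    add_nonneg (hd k) (mul_nonneg (neg_nonneg.2 (hv i)) (Nat.cast_nonneg _)), fun l => ?_⟩
  rw [LinearEquiv.mul_apply, s_apply_apply, h, hn]
  simp only [add_mul, Finset.sum_add_distrib, mul_assoc, ← Finset.mul_sum]
  ring

/-- A common threshold for finitely many inequalities. Absolute values keep the summands with f j ≤
0 harmless. -/
theorem exists_pos_mul_add_pos (f g : I → ℝ) :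
    ∃ N : ℝ, 0 < N ∧ ∀ j, 0 < f j → 0 < N * f j + g j := by
  have hnn : ∀ j, 0 ≤ |g j| / |f j| := fun j => by positivity
  refine ⟨1 + ∑ j, |g j| / |f j|, by
    have := Finset.sum_nonneg fun j (_ : j ∈ Finset.univ) => hnn j
    linarith, fun j hj => ?_⟩
  have h1 := Finset.single_le_sum (fun j _ => hnn j) (Finset.mem_univ j)
  rw [abs_of_pos hj, div_le_iff₀ hj] at h1
  have := neg_abs_le (g j)
  linarith

variable {Θ₁ Θ₂ : Set I} {c₁ c₂ : I → ℝ} {τ : Dual ℝ V ≃ₗ[ℝ] Dual ℝ V}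

/-- For a minimal double coset representative, a combination of antidominant vectors of `Θ₁` and
of the translate of `Θ₂` is antidominant. -/
theorem exists_isAntidominant_union (hc₁ : IsAntidominant A c₁ Θ₁)
    (hc₂ : IsAntidominant A c₂ Θ₂) (hτ : τ ∈ R.weylGroup)
    (hL : ∀ j ∈ Θ₁ ∪ perp A Θ₁, R.length τ ≤ R.length (R.s j * τ))
    (hR : ∀ j ∈ Θ₂ ∪ perp A Θ₂, R.length τ ≤ R.length (τ * R.s j)) :
    ∃ (c : I → ℝ) (N : ℝ), 0 < N ∧ IsAntidominant A c (Θ₁ ∪ Θ₂ ∪ R.red τ) ∧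
      ∀ l : Dual ℝ V, l (R.coVec c) = N * l (R.coVec c₁) + τ⁻¹ l (R.coVec c₂) := by
  have hτ' := inv_mem hτ
  obtain ⟨d, hd, hd'⟩ := R.exists_apply_eq_add (hc₂.α_nonpos R) hτ'
  obtain ⟨N, hN, hNj⟩ := exists_pos_mul_add_pos (fun j => -R.α j (R.coVec c₁))
    fun j => -τ⁻¹ (R.α j) (R.coVec c₂)
  -- The coordinates of N v₁ + τ v₂, where d records τ v₂ - v₂.
  set c : I → ℝ := fun k => N * c₁ k + (c₂ k + d k) with hc
  have hc_apply : ∀ l : Dual ℝ V,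
      l (R.coVec c) = N * l (R.coVec c₁) + τ⁻¹ l (R.coVec c₂) := by
    intro l
    rw [hd', apply_coVec, apply_coVec, apply_coVec, Finset.mul_sum, ← Finset.sum_add_distrib,
      ← Finset.sum_add_distrib]
    exact Finset.sum_congr rfl fun k _ => by rw [hc]; ring
  have hc0 : ∀ k, 0 ≤ c k := fun k =>
    add_nonneg (mul_nonneg hN.le (hc₁.nonneg k)) (add_nonneg (hc₂.nonneg k) (hd k))
  have hcα : ∀ j, R.α j (R.coVec c) ≤ 0 := by
    intro j
    rw [hc_apply]
    by_cases hj : j ∈ Θ₁ ∪ perp A Θ₁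
    · have h1 := hc₁.α_nonpos R j
      obtain ⟨n, hn⟩ := R.root_nonneg hτ' (i := j) (by
        rw [R.length_inv hτ, ← R.length_s_mul hτ]; exact hL j hj)
      have h2 : τ⁻¹ (R.α j) (R.coVec c₂) ≤ 0 := by
        rw [hn]
        simp only [LinearMap.sum_apply, LinearMap.smul_apply]
        exact Finset.sum_nonpos fun k _ =>
          smul_nonpos_of_nonneg_of_nonpos (Nat.zero_le _) (hc₂.α_nonpos R k)
      have := mul_nonpos_of_nonneg_of_nonpos hN.le h1
      linarith
    · have := hNj j (by have := hc₁.α_neg R hj; linarith)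
      linarith
  have hanti : IsAntidominant A c {k | c k ≠ 0} :=
    ⟨fun k hk => (hc0 k).lt_of_ne (Ne.symm hk), fun k hk => by simpa using hk, fun j => by
      rw [← R.α_coVec]; exact hcα j⟩
  have hsupp : {k | c k ≠ 0} = Θ₁ ∪ Θ₂ ∪ R.red τ := by
    apply Set.Subset.antisymm
    · intro k hk
      by_contra hk'
      simp only [Set.mem_union, not_or] at hk'
      obtain ⟨⟨hk1, hk2⟩, hk3⟩ := hk'
      obtain ⟨l, hl, hl1, hl0⟩ := R.exists_fundamental k
      have h1 := hc_apply l
      rw [R.apply_of_mem_parabolic (inv_mem (R.mem_parabolic_red hτ))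
          (fun j hj => hl0 j fun h => hk3 (h ▸ hj)),
        hc₁.apply_eq_zero R (fun j hj => hl0 j fun h => hk1 (h ▸ hj)),
        hc₂.apply_eq_zero R (fun j hj => hl0 j fun h => hk2 (h ▸ hj)),
        apply_coVec, R.apply_h_eq_sum hl1 hl0] at h1
      exact hk (by linarith)
    · refine Set.union_subset (Set.union_subset (fun k hk => ?_) fun k hk => ?_) ?_
      · have h1 := mul_pos hN (hc₁.pos k hk)
        have h2 := hc₂.nonneg k
        have h3 := hd k
        exact (by simp only [hc]; linarith : 0 < c k).ne'
      · have h1 := mul_nonneg hN.le (hc₁.nonneg k)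
        have h2 := hc₂.pos k hk
        have h3 := hd k
        exact (by simp only [hc]; linarith : 0 < c k).ne'
      · obtain ⟨l, hl, hl0, hl1⟩ := R.exists_generic {k | c k ≠ 0}
        have h0 := hanti.apply_eq_zero R hl0
        rw [hc_apply] at h0
        have h1 := mul_nonneg hN.le (hc₁.apply_nonneg_of_mem_closedChamber R hl)
        have h2 := hc₂.apply_nonneg R
          (R.apply_mem_titsCone hτ' (R.closedChamber_subset_titsCone hl))
        have h3 := R.mem_parabolic_of_apply_eq_zero (T := Θ₂ ∪ perp A Θ₂) (hc₂.α_nonpos R)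
          (fun j hj => hc₂.α_neg R hj)
          (fun m hm => hc₂.apply_nonneg_of_mem_closedChamber R hm) hl hτ'
          (fun k hk => by
            rw [R.length_s_mul hτ', inv_inv, R.length_inv hτ]; exact hR k hk) (by linarith)
        refine R.red_subset_of_mem_parabolic ?_
        rw [← inv_inv τ]
        refine inv_mem (R.parabolic_mono (fun k hk => ?_) h3)
        by_contra hk'
        have : l (R.h k) = 0 := hk
        rw [hl1 k hk'] at this
        exact one_ne_zero this
  exact ⟨c, N, hN, hsupp ▸ hanti, hc_apply⟩

/-- Both exposing functionals are nonnegative on X, so a positive combination of them vanishes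
exactly where both do. -/
theorem specialFace_inter_image (hc₁ : IsAntidominant A c₁ Θ₁)
    (hc₂ : IsAntidominant A c₂ Θ₂) (hτ : τ ∈ R.weylGroup)
    (hL : ∀ j ∈ Θ₁ ∪ perp A Θ₁, R.length τ ≤ R.length (R.s j * τ))
    (hR : ∀ j ∈ Θ₂ ∪ perp A Θ₂, R.length τ ≤ R.length (τ * R.s j)) :
    R.specialFace Θ₁ ∩ τ '' R.specialFace Θ₂ = R.specialFace (Θ₁ ∪ Θ₂ ∪ R.red τ) := by
  obtain ⟨c, N, hN, hc, hc'⟩ := R.exists_isAntidominant_union hc₁ hc₂ hτ hL hR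
  have hτ' := inv_mem hτ
  ext l
  rw [hc.mem_specialFace_iff R, hc', Set.mem_inter_iff, hc₁.mem_specialFace_iff R]
  have himage : l ∈ τ '' R.specialFace Θ₂ ↔ l ∈ R.titsCone ∧ τ⁻¹ l (R.coVec c₂) = 0 := by
    rw [← R.apply_mem_titsCone_iff hτ', ← hc₂.mem_specialFace_iff R]
    constructor
    · rintro ⟨m, hm, rfl⟩
      rwa [inv_apply_self]
    · exact fun h => ⟨_, h, apply_inv_self τ l⟩
  rw [himage]
  constructor
  · rintro ⟨⟨hl, h1⟩, -, h2⟩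
    exact ⟨hl, by rw [h1, h2]; simp⟩
  · rintro ⟨hl, h⟩
    have h1 := mul_nonneg hN.le (hc₁.apply_nonneg R hl)
    have h2 := hc₂.apply_nonneg R (R.apply_mem_titsCone hτ' hl)
    exact ⟨⟨hl, (mul_eq_zero.1 (by linarith : N * l (R.coVec c₁) = 0)).resolve_left hN.ne'⟩,
      hl, by linarith⟩

end KacMoody.Realization

namespace KacMoody.Realization

variable {I V : Type*} [AddCommGroup V] [Module ℝ V] {A : Matrix I I ℤ} (R : Realization A V)
  {w : Dual ℝ V ≃ₗ[ℝ] Dual ℝ V} {l : Dual ℝ V}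

/-! ### Finite type -/

/-- The realization of a principal submatrix. -/
def sub (J : Set I) : Realization (A.submatrix (Subtype.val : J → I) Subtype.val) V where
  h i := R.h i
  α i := R.α i
  linearIndependent_h := R.linearIndependent_h.comp _ Subtype.val_injective
  linearIndependent_α := R.linearIndependent_α.comp _ Subtype.val_injective
  pairing i j := R.pairing i j
  isGCM := R.isGCM.submatrix J

theorem sub_weylGroup (J : Set I) : (R.sub J).weylGroup = R.parabolic J := by
  rw [parabolic, Set.image_eq_range]
  rfl

variable [Fintype I]

/-- The Tits cone as a pointed cone. -/
def titsPointedCone : PointedCone ℝ (Dual ℝ V) where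
  carrier := R.titsCone
  add_mem' := R.add_mem_titsCone
  zero_mem' := R.zero_mem_titsCone
  smul_mem' t _ hl := R.smul_mem_titsCone t.2 hl

theorem exists_smul_add_mem_closedChamber {ρ : Dual ℝ V} (hρ : ∀ i, ρ (R.h i) = 1)
    (y : Dual ℝ V) : ∃ N : ℝ, 0 < N ∧ N • ρ + y ∈ R.closedChamber := by
  obtain ⟨N, hN, h⟩ := exists_pos_mul_add_pos (fun _ : I => (1 : ℝ)) fun i => y (R.h i)
  exact ⟨N, hN, fun i => by simpa [hρ] using (h i one_pos).le⟩

/-- If the Tits cone is not the whole space, then there is a nonzero linear functional which is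
nonnegative on it. -/
theorem exists_nonneg_on_titsCone [Nonempty I] (h : R.titsCone ≠ Set.univ) {ρ : Dual ℝ V}
    (hρ : ∀ i, ρ (R.h i) = 1) :
    ∃ g : Dual ℝ (Dual ℝ V), (∀ x ∈ R.titsCone, 0 ≤ g x) ∧ g ρ = 1 := by
  -- Every y becomes dominant after adding a multiple of ρ; with -ρ in the cone, that multiple could
  -- be subtracted again.
  have hneg : -ρ ∉ R.titsCone := fun hmem => h <| Set.eq_univ_of_forall fun y => by
    obtain ⟨N, hN, hy⟩ := R.exists_smul_add_mem_closedChamber hρ y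
    have := R.add_mem_titsCone (R.closedChamber_subset_titsCone hy)
      (R.smul_mem_titsCone hN.le hmem)
    rwa [smul_neg, add_comm, neg_add_cancel_left] at this
  have hρ0 : ρ ≠ 0 := fun h0 => by
    have := hρ (Classical.arbitrary I)
    simp [h0] at this
  let f : Dual ℝ V →ₗ.[ℝ] ℝ := LinearPMap.mkSpanSingleton ρ 1 hρ0
  have hf : ∀ (t : ℝ) (ht : t • ρ ∈ f.domain), f ⟨t • ρ, ht⟩ = t := fun t ht =>
    (LinearPMap.mkSpanSingleton'_apply ρ (1 : ℝ) _ t ht).trans (by simp)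
  obtain ⟨g, hg, hg'⟩ := riesz_extension R.titsPointedCone f (fun ⟨x, hx⟩ hxX => by
    obtain ⟨t, rfl⟩ := Submodule.mem_span_singleton.1 hx
    rw [hf]
    by_contra! ht
    apply hneg
    have := R.smul_mem_titsCone (inv_nonneg.2 (neg_nonneg.2 ht.le)) hxX
    rwa [smul_smul, inv_neg, neg_mul, inv_mul_cancel₀ ht.ne, neg_one_smul] at this) (fun y => by
    obtain ⟨N, -, hy⟩ := R.exists_smul_add_mem_closedChamber hρ y
    exact ⟨⟨N • ρ, Submodule.smul_mem _ _ (Submodule.mem_span_singleton_self ρ)⟩,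
      R.closedChamber_subset_titsCone hy⟩)
  refine ⟨g, fun x hx => hg' x hx, ?_⟩
  have h1 : (1 : ℝ) • ρ ∈ f.domain :=
    Submodule.smul_mem _ _ (Submodule.mem_span_singleton_self ρ)
  have := hg ⟨(1 : ℝ) • ρ, h1⟩
  rw [hf] at this
  simpa using this

/-- In finite type, a functional which is nonnegative on the Tits cone takes arbitrarily small
values on the Weyl group orbit of a dominant combination of simple roots. -/
theorem exists_apply_le_pow [Nonempty I] {u : I → ℝ} (hu : ∀ i, 0 < u i) {φ : Dual ℝ V}
    (hφu : φ = ∑ j, u j • R.α j) {μ : ℝ} (hμ : ∀ i, μ ≤ φ (R.h i)) (hμ0 : 0 < μ)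
    {g : Dual ℝ (Dual ℝ V)} (hg : ∀ x ∈ R.titsCone, 0 ≤ g x) (n : ℕ) :
    ∃ w ∈ R.weylGroup, g (w φ) ≤ (1 - μ / (μ + ∑ j, u j)) ^ n * g φ := by
  have hU : 0 < ∑ j, u j := Finset.sum_pos (fun j _ => hu j) Finset.univ_nonempty
  have hφ : φ ∈ R.titsCone := R.closedChamber_subset_titsCone fun i => hμ0.le.trans (hμ i)
  -- Adding μ to the denominator keeps the contraction factor nonnegative without comparing μ with ∑
  -- u j.
  have hδ : 0 ≤ 1 - μ / (μ + ∑ j, u j) := by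
    rw [sub_nonneg, div_le_one (by linarith)]
    linarith
  induction n with
  | zero => exact ⟨1, one_mem _, by simp⟩
  | succ n ih =>
    obtain ⟨w, hw, h⟩ := ih
    have hsum : g (w φ) = ∑ j, u j * g (w (R.α j)) := by
      conv_lhs => rw [hφu]
      simp
    have hg0 : 0 ≤ g (w φ) := hg _ (R.apply_mem_titsCone hw hφ)
    -- By averaging, some g (w (α j)) is at least g (w φ) / ∑ u j; appending s_j then contracts the
    -- value.
    obtain ⟨j, -, hj⟩ : ∃ j ∈ Finset.univ,
        g (w φ) / (∑ j, u j) * u j ≤ u j * g (w (R.α j)) := by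
      apply Finset.exists_le_of_sum_le Finset.univ_nonempty
      rw [← Finset.mul_sum, div_mul_cancel₀ _ hU.ne', hsum]
    rw [mul_comm, mul_le_mul_iff_right₀ (hu j)] at hj
    refine ⟨w * R.s j, mul_mem hw (R.s_mem_weylGroup j), ?_⟩
    rw [LinearEquiv.mul_apply, s_apply, map_sub, map_smul, map_sub, map_smul, smul_eq_mul]
    have h1 : μ * (g (w φ) / ∑ j, u j) ≤ φ (R.h j) * g (w (R.α j)) :=
      mul_le_mul (hμ j) hj (by positivity) (hμ0.le.trans (hμ j))
    have h2 : μ / (μ + ∑ j, u j) * g (w φ) ≤ μ * (g (w φ) / ∑ j, u j) := by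
      rw [mul_div_assoc', div_mul_eq_mul_div]
      exact div_le_div_of_nonneg_left (by positivity) hU (by linarith)
    have h3 := mul_le_mul_of_nonneg_left h hδ
    rw [pow_succ']
    linarith

/-- In finite type the Tits cone is the whole space. -/
theorem titsCone_eq_univ {u : I → ℝ} (hu : ∀ i, 0 < u i)
    (hAu : ∀ i, 0 < ∑ j, u j * (A i j : ℝ)) : R.titsCone = Set.univ := by
  rcases isEmpty_or_nonempty I with hI | hI
  · exact Set.eq_univ_of_forall fun y => R.closedChamber_subset_titsCone fun i => hI.elim i
  by_contra hne
  obtain ⟨ρ, hρ⟩ := R.exists_eval_h fun _ => 1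
  obtain ⟨g, hg, hgρ⟩ := R.exists_nonneg_on_titsCone hne hρ
  obtain ⟨φ, hφu⟩ : ∃ φ, φ = ∑ j, u j • R.α j := ⟨_, rfl⟩
  have hφ : ∀ i, 0 < φ (R.h i) := fun i => by simpa [hφu, R.pairing] using hAu i
  obtain ⟨i0, -, hi0⟩ := Finset.exists_min_image Finset.univ (fun i => φ (R.h i))
    Finset.univ_nonempty
  set μ := φ (R.h i0) with hμdef
  have hμ0 : 0 < μ := hφ i0
  have hμ : ∀ i, μ ≤ φ (R.h i) := fun i => hi0 i (by simp)
  have hφC : φ ∈ R.closedChamber := fun i => (hφ i).le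
  have hgφ : 0 < g φ := by
    have h1 : φ - μ • ρ ∈ R.closedChamber := fun i => by simpa [hρ] using hμ i
    have h2 := hg _ (R.closedChamber_subset_titsCone h1)
    rw [map_sub, map_smul, hgρ, smul_eq_mul, mul_one] at h2
    linarith
  obtain ⟨j, hj⟩ : ∃ j, 0 < g (R.α j) := by
    by_contra! hcon
    rw [hφu, map_sum] at hgφ
    refine hgφ.not_ge (Finset.sum_nonpos fun j _ => ?_)
    rw [map_smul, smul_eq_mul]
    exact mul_nonpos_of_nonneg_of_nonpos (hu j).le (hcon j)
  -- `g` and `g ∘ s_j` differ by a multiple of the coroot `h j`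
  let g' : Dual ℝ (Dual ℝ V) := g + g ∘ₗ (R.s j).toLinearMap
  have hg'x : ∀ x, g' x = g x + g (R.s j x) := fun x => rfl
  have hgs : ∀ x, g (R.s j x) = g x - x (R.h j) * g (R.α j) := fun x => by
    rw [s_apply, map_sub, map_smul, smul_eq_mul]
  -- Two nonnegative numbers differing by x (h j) * g (α j) have a sum at least the absolute value
  -- of that difference.
  have hbound : ∀ x ∈ R.titsCone, |x (R.h j)| * g (R.α j) ≤ g' x := by
    intro x hx
    have h1 := hg x hx
    have h2 := hg _ (R.apply_mem_titsCone (R.s_mem_weylGroup j) hx)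
    rw [hg'x]
    have h3 := hgs x
    rcases abs_cases (x (R.h j)) with ⟨h, -⟩ | ⟨h, -⟩ <;> rw [h] <;> linarith
  have hg' : ∀ x ∈ R.titsCone, 0 ≤ g' x := fun x hx =>
    (mul_nonneg (abs_nonneg _) hj.le).trans (hbound x hx)
  -- The number (w φ)(h j) is, up to sign, a nonzero combination of the values φ (h k) ≥ μ with
  -- natural coefficients. This integrality bounds g' below on the orbit, against the geometric
  -- decay of `exists_apply_le_pow`.
  have hlow : ∀ w ∈ R.weylGroup, μ * g (R.α j) ≤ g' (w φ) := by
    intro w hw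
    refine (mul_le_mul_of_nonneg_right ?_ hj.le).trans
      (hbound _ (R.apply_mem_titsCone hw (R.closedChamber_subset_titsCone hφC)))
    have hsum : ∀ n : I → ℕ, (∃ k, n k ≠ 0) → μ ≤ ∑ k, n k * φ (R.h k) := by
      rintro n ⟨k, hk⟩
      have hk1 : (1 : ℝ) ≤ n k := by exact_mod_cast Nat.one_le_iff_ne_zero.2 hk
      have h1 := Finset.single_le_sum (f := fun k => (n k : ℝ) * φ (R.h k))
        (fun k _ => mul_nonneg (Nat.cast_nonneg _) (hφC k)) (Finset.mem_univ k)
      have h2 := mul_le_mul hk1 (hμ k) hμ0.le (Nat.cast_nonneg _)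
      rw [one_mul] at h2
      exact h2.trans h1
    rcases le_total (R.length w) (R.length (R.s j * w)) with hle | hle
    · obtain ⟨n, hn⟩ := R.coroot_nonneg hw hle
      rw [hn]
      exact (hsum n (R.coeff_coroot_ne_zero hn)).trans (le_abs_self _)
    · obtain ⟨n, hn⟩ := R.coroot_nonpos hw hle
      rw [hn, abs_neg]
      refine (hsum n ?_).trans (le_abs_self _)
      by_contra! h0
      obtain ⟨l, hl⟩ := R.exists_apply_h_ne_zero w j
      simp [hn, h0] at hl
  have hU : 0 < ∑ j, u j := Finset.sum_pos (fun j _ => hu j) Finset.univ_nonempty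
  have hg'φ : 0 < g' φ :=
    (mul_pos hμ0 hj).trans_le (by simpa using hlow 1 (one_mem _))
  obtain ⟨n, hn⟩ := exists_pow_lt_of_lt_one (div_pos (mul_pos hμ0 hj) hg'φ)
    (show 1 - μ / (μ + ∑ j, u j) < 1 by
      have : 0 < μ / (μ + ∑ j, u j) := by positivity
      linarith)
  obtain ⟨w, hw, hle⟩ := R.exists_apply_le_pow hu hφu hμ hμ0 hg' n
  rw [lt_div_iff₀ hg'φ] at hn
  exact absurd ((hlow w hw).trans hle) hn.not_ge

end KacMoody.Realization

namespace KacMoody.Realization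

variable {I V : Type*} [AddCommGroup V] [Module ℝ V] {A : Matrix I I ℤ} (R : Realization A V)
  {Θ₁ Θ₂ J : Set I} {i j : I} {τ : Dual ℝ V ≃ₗ[ℝ] Dual ℝ V} [Fintype I]

/-! ### Joins of translated special faces -/

/-- A vector of the closed chamber is an algebraic interior point of the special face of the
non-finite part of its type. -/
theorem exists_smul_add_mem_titsCone {p : Dual ℝ V} (hp : p ∈ R.closedChamber)
    (hJ : ∀ i, p (R.h i) = 0 ↔ i ∈ J) {v : Dual ℝ V} (hv : ∀ i ∈ infPart A J, v (R.h i) = 0) :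
    ∃ N : ℝ, 0 < N ∧ N • p + v ∈ R.titsCone := by
  classical
  obtain ⟨u, hu, hu0, hAu⟩ := R.isGCM.exists_pos_diff_infPart J
  -- The finite-type part of J can move v to a vector dominant on J \ J^∞. Its group fixes p and
  -- preserves values on coroots of J^∞; a large N handles the indices outside J.
  have huniv : (R.sub (J \ infPart A J)).titsCone = Set.univ := by
    refine titsCone_eq_univ _ (u := fun i => u i) (fun i => hu i i.2) fun i => ?_
    have h1 := sum_subtype_mul (J \ infPart A J) (fun j => (A i j : ℝ)) (fun j => u j)
    refine (hAu i i.2).trans_eq (Eq.trans ?_ (h1.trans (by congr!)))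
    refine Finset.sum_congr rfl fun j _ => ?_
    split_ifs with hj
    · rfl
    · rw [hu0 j hj]
  obtain ⟨w, hw, m, hm, rfl⟩ : v ∈ (R.sub (J \ infPart A J)).titsCone := huniv ▸ Set.mem_univ v
  rw [sub_weylGroup] at hw
  have hm0 : ∀ i ∈ infPart A J, m (R.h i) = 0 := fun i hi => by
    rw [← R.apply_h_of_mem_perp
      (R.parabolic_mono (R.isGCM.diff_infPart_subset_perp J) hw) hi, hv i hi]
  obtain ⟨N, hN, hNi⟩ := exists_pos_mul_add_pos (fun i => p (R.h i)) fun i => m (R.h i)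
  refine ⟨N, hN, w, R.parabolic_le_weylGroup _ hw, N • p + m, fun i => ?_, ?_⟩
  · change 0 ≤ N * p (R.h i) + m (R.h i)
    by_cases hi : i ∈ J
    · rw [(hJ i).2 hi, mul_zero, zero_add]
      by_cases hi' : i ∈ infPart A J
      · exact (hm0 i hi').ge
      · exact hm ⟨i, hi, hi'⟩
    · exact (hNi i ((hp i).lt_of_ne fun h => hi ((hJ i).1 h.symm))).le
  · rw [map_add, map_smul, R.apply_of_mem_parabolic hw fun i hi => (hJ i).2 hi.1]

/-- A face containing a vector of the closed chamber contains the special face of the non-finite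
part of its type. -/
theorem IsFace.specialFace_infPart_subset {F : Set (Dual ℝ V)} (hF : R.IsFace F) {p : Dual ℝ V}
    (hp : p ∈ R.closedChamber) (hJ : ∀ i, p (R.h i) = 0 ↔ i ∈ J) (hpF : p ∈ F) :
    R.specialFace (infPart A J) ⊆ F := by
  intro x hx
  obtain ⟨N, hN, hmem⟩ := R.exists_smul_add_mem_titsCone hp hJ (v := p - x) fun i hi => by
    rw [LinearMap.sub_apply, (hJ i).2 (infPart_subset hi), R.apply_h_of_mem_specialFace hx hi,
      sub_zero]
  have hmem' := R.smul_mem_titsCone (inv_nonneg.2 hN.le) hmem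
  -- The point p lies on the open segment from x to p + (p - x) / N, with weights 1 / (N + 1) and N
  -- / (N + 1).
  refine hF.2.2.2 (R.specialFace_subset_titsCone hx) hmem' hpF
    ⟨1 / (N + 1), N / (N + 1), by positivity, by positivity, by field_simp; ring, ?_⟩
  rw [smul_smul, show N / (N + 1) * N⁻¹ = 1 / (N + 1) by field_simp, ← smul_add,
    show x + (N • p + (p - x)) = (N + 1) • p by module, smul_smul,
    one_div_mul_cancel (by positivity), one_smul]

omit [Fintype I] in
theorem length_inv_le_s_mul_inv (hτ : τ ∈ R.weylGroup) :
    R.length τ⁻¹ ≤ R.length (R.s j * τ⁻¹) ↔ R.length τ ≤ R.length (τ * R.s j) := by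
  rw [R.length_s_mul (inv_mem hτ), inv_inv, R.length_inv hτ]

theorem apply_eq_sum {n : I → ℝ} {g : Dual ℝ (Dual ℝ V)} {k : I} (h1 : g (R.α k) = 1)
    (h0 : ∀ j ≠ k, g (R.α j) = 0) : ∑ j, n j * g (R.α j) = n k := by
  rw [Finset.sum_eq_single k (fun j _ hj => by rw [h0 j hj, mul_zero]) (by simp), h1, mul_one]

open Classical in
omit [Fintype I] in
theorem exists_dual_fundamental (i : I) :
    ∃ g : Dual ℝ (Dual ℝ V), g (R.α i) = 1 ∧ ∀ j ≠ i, g (R.α j) = 0 := by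
  obtain ⟨g, hg⟩ := R.exists_eval_α (Pi.single i 1)
  exact ⟨g, by simp [hg], fun j hj => by simp [hg, hj]⟩

/-- If a positive coroot translate is a simple coroot, then so is the root translate. -/
theorem apply_α_eq_of_coroot (hτ : τ ∈ R.weylGroup) (hj : R.length τ ≤ R.length (τ * R.s j))
    (h : ∀ l, τ⁻¹ l (R.h j) = l (R.h i)) : τ (R.α j) = R.α i := by
  obtain ⟨n, hn⟩ := R.root_nonneg hτ hj
  have hu := mul_mem (R.s_mem_weylGroup i) hτ
  have hle : R.length (R.s i * τ * R.s j) ≤ R.length (R.s i * τ) := by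
    by_contra! hlt
    rw [← R.length_inv hu, ← inv_inv (R.s i * τ),
      ← R.length_s_mul (inv_mem hu), inv_inv] at hlt
    obtain ⟨l, hl, hl1, -⟩ := R.exists_fundamental i
    have := R.coroot_nonneg_apply (inv_mem hu) hlt.le hl
    rw [mul_inv_rev, s_inv, LinearEquiv.mul_apply, h, s_apply_apply, hl1, R.pairing,
      R.isGCM.diag] at this
    norm_num at this
  obtain ⟨m, hm⟩ := R.root_nonpos hu hle
  have h2 : τ (R.α j) (R.h i) = 2 := by
    rw [← h, inv_apply_self, R.pairing, R.isGCM.diag]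
    norm_num
  rw [LinearEquiv.mul_apply, s_apply, h2, hn] at hm
  -- The root τ α j is positive while τ α j - 2 α i is negative, so only the coefficient at i
  -- survives; pairing with h i then shows that it is 1.
  have hk : ∀ k ≠ i, n k = 0 := fun k hk => by
    obtain ⟨g, hg1, hg0⟩ := R.exists_dual_fundamental k
    have := congrArg g hm
    simp only [map_sub, map_neg, map_sum, map_smul, map_nsmul, nsmul_eq_mul, hg0 i hk.symm,
      smul_zero, sub_zero] at this
    rw [R.apply_eq_sum (n := fun k => (n k : ℝ)) hg1 hg0,
      R.apply_eq_sum (n := fun k => (m k : ℝ)) hg1 hg0] at this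
    have h3 : (n k : ℝ) + m k = 0 := by linarith
    have h4 : n k + m k = 0 := by exact_mod_cast h3
    omega
  rw [Finset.sum_eq_single i (fun k _ hki => by rw [hk k hki, zero_smul]) (by simp)] at hn
  rw [hn, LinearMap.smul_apply, R.pairing, R.isGCM.diag] at h2
  have h3 : (n i : ℝ) * 2 = 2 := by simpa using h2
  have h4 : n i = 1 := by
    have : (n i : ℝ) = 1 := by linarith
    exact_mod_cast this
  rw [hn, h4, one_smul]

/-- If a positive root translate is a simple root, then so is the coroot translate. -/
theorem coroot_eq_of_apply_α (hτ : τ ∈ R.weylGroup) (hj : R.length τ ≤ R.length (τ * R.s j))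
    (h : R.α i = τ (R.α j)) (l : Dual ℝ V) : τ⁻¹ l (R.h j) = l (R.h i) := by
  obtain ⟨n, hn⟩ := R.coroot_nonneg (inv_mem hτ) ((R.length_inv_le_s_mul_inv hτ).2 hj)
  have hu := mul_mem (R.s_mem_weylGroup i) hτ
  have hle : R.length (R.s i * τ * R.s j) ≤ R.length (R.s i * τ) := by
    by_contra! hlt
    obtain ⟨m, hm⟩ := R.root_nonneg hu hlt.le
    rw [LinearEquiv.mul_apply, ← h, s_apply, R.pairing, R.isGCM.diag] at hm
    obtain ⟨g, hg1, hg0⟩ := R.exists_dual_fundamental i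
    have := congrArg g hm
    simp only [map_sub, map_sum, map_smul, map_nsmul, nsmul_eq_mul, hg1] at this
    rw [R.apply_eq_sum (n := fun k => (m k : ℝ)) hg1 hg0] at this
    have h0 : (0 : ℝ) ≤ m i := Nat.cast_nonneg _
    norm_num at this
    linarith
  have hle' : R.length (R.s j * (R.s i * τ)⁻¹) ≤ R.length (R.s i * τ)⁻¹ := by
    rwa [R.length_s_mul (inv_mem hu), inv_inv, R.length_inv hu]
  obtain ⟨m, hm⟩ := R.coroot_nonpos (inv_mem hu) hle'
  have h2 : τ⁻¹ (R.α i) (R.h j) = 2 := by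
    rw [h, inv_apply_self, R.pairing, R.isGCM.diag]
    norm_num
  have hk : ∀ k ≠ i, n k = 0 := fun k hk => by
    obtain ⟨l, -, hl1, hl0⟩ := R.exists_fundamental k
    have := hm l
    rw [mul_inv_rev, s_inv, LinearEquiv.mul_apply, s_apply, hl0 i hk.symm, zero_smul, sub_zero,
      hn, R.apply_h_eq_sum (n := fun k => (n k : ℝ)) hl1 hl0,
      R.apply_h_eq_sum (n := fun k => (m k : ℝ)) hl1 hl0] at this
    have h3 : (n k : ℝ) + m k = 0 := by linarith
    have h4 : n k + m k = 0 := by exact_mod_cast h3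
    omega
  have hn' : ∀ l, τ⁻¹ l (R.h j) = n i * l (R.h i) := fun l => by
    rw [hn, Finset.sum_eq_single i (fun k _ hki => by rw [hk k hki]; simp) (by simp)]
  rw [hn', R.pairing, R.isGCM.diag] at h2
  have h3 : (n i : ℝ) = 1 := by
    push_cast at h2
    linarith
  rw [hn', h3, one_mul]

/-- If a coroot `τ⁻¹ h i` with `i ∈ Θ₁` is supported on `Θ₂`, then it is a simple coroot. -/
theorem mem_interTranslate (hτ : τ ∈ R.weylGroup) (hi : i ∈ Θ₁)
    (hL : R.length τ ≤ R.length (R.s i * τ))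
    (hR : ∀ j ∈ Θ₂, R.length τ ≤ R.length (τ * R.s j)) {m : Dual ℝ V}
    (hm : m ∈ R.closedChamber) (hm1 : ∀ j ∉ Θ₂, m (R.h j) = 1) (h : τ m (R.h i) = 0) :
    i ∈ R.interTranslate Θ₁ τ Θ₂ := by
  obtain ⟨n, hn⟩ := R.coroot_nonneg hτ hL
  rw [hn, Finset.sum_eq_zero_iff_of_nonneg
    fun k _ => mul_nonneg (Nat.cast_nonneg _) (hm k)] at h
  have hn0 : ∀ k ∉ Θ₂, n k = 0 := fun k hk => by
    have := h k (by simp)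
    rw [hm1 k hk, mul_one] at this
    exact_mod_cast this
  have hM : ∀ k, ∃ M : I → ℕ, k ∈ Θ₂ → ∀ l, τ⁻¹ l (R.h k) = ∑ t, M t * l (R.h t) := fun k => by
    by_cases hk : k ∈ Θ₂
    · obtain ⟨M, hM⟩ := R.coroot_nonneg (inv_mem hτ)
        ((R.length_inv_le_s_mul_inv hτ).2 (hR k hk))
      exact ⟨M, fun _ => hM⟩
    · exact ⟨0, fun h => absurd h hk⟩
  choose M hM using hM
  -- Substituting τ h k = ∑ M k t • h t into h i = ∑ n k • τ h k expresses a simple coroot by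
  -- natural coefficients. Such an expression has only one nonzero term, so some τ h k equals h i.
  have key : ∀ t, ∀ l : Dual ℝ V, l (R.h t) = 1 → (∀ k ≠ t, l (R.h k) = 0) →
      l (R.h i) = ((∑ k, n k * M k t : ℕ) : ℝ) := by
    intro t l hl1 hl0
    conv_lhs => rw [← apply_inv_self τ l, hn]
    push_cast
    refine Finset.sum_congr rfl fun k _ => ?_
    by_cases hk : k ∈ Θ₂
    · rw [hM k hk, R.apply_h_eq_sum (n := fun t => (M k t : ℝ)) hl1 hl0]
    · rw [hn0 k hk]
      simp
  have hone : ∑ k, n k * M k i = 1 := by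
    obtain ⟨l, -, hl1, hl0⟩ := R.exists_fundamental i
    have := key i l hl1 hl0
    rw [hl1] at this
    exact_mod_cast this.symm
  have hzero : ∀ t ≠ i, ∀ k, n k * M k t = 0 := by
    intro t ht k
    obtain ⟨l, -, hl1, hl0⟩ := R.exists_fundamental t
    have := key t l hl1 hl0
    rw [hl0 i ht.symm] at this
    have h0 : ∑ k, n k * M k t = 0 := by exact_mod_cast this.symm
    exact Finset.sum_eq_zero_iff.1 h0 k (by simp)
  obtain ⟨k, -, hk⟩ := Finset.exists_ne_zero_of_sum_ne_zero (hone ▸ one_ne_zero)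
  have hk1 : n k * M k i = 1 := by
    have hle : n k * M k i ≤ 1 := by
      rw [← hone]
      exact Finset.single_le_sum (f := fun k => n k * M k i) (fun _ _ => Nat.zero_le _)
        (Finset.mem_univ k)
    omega
  obtain ⟨hnk, hMk⟩ := mul_eq_one.1 hk1
  have hkΘ : k ∈ Θ₂ := by
    by_contra hkΘ
    rw [hn0 k hkΘ] at hnk
    exact zero_ne_one hnk
  refine ⟨hi, k, hkΘ, (R.apply_α_eq_of_coroot hτ (hR k hkΘ) fun l => ?_).symm⟩
  rw [hM k hkΘ, Finset.sum_eq_single i (fun t _ ht => ?_) (by simp), hMk]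
  · simp
  · have := hzero t ht k
    rw [hnk, one_mul] at this
    rw [this]
    simp

/-- If α i = τ α j with j ∈ Θ₂, then τ⁻¹ carries h i to h j, so h i vanishes on τ R(Θ₂). -/
theorem image_specialFace_subset (hτ : τ ∈ R.weylGroup)
    (hR : ∀ j ∈ Θ₂, R.length τ ≤ R.length (τ * R.s j)) :
    τ '' R.specialFace Θ₂ ⊆ R.specialFace (infPart A (R.interTranslate Θ₁ τ Θ₂)) := by
  obtain ⟨c, hc⟩ := R.isGCM.exists_isAntidominant_infPart (R.interTranslate Θ₁ τ Θ₂)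
  rintro _ ⟨l, hl, rfl⟩
  rw [hc.mem_specialFace_iff R]
  refine ⟨R.apply_mem_titsCone hτ (R.specialFace_subset_titsCone hl),
    hc.apply_eq_zero R fun i hi => ?_⟩
  obtain ⟨-, j, hj, hij⟩ := infPart_subset hi
  rw [← R.coroot_eq_of_apply_α hτ (hR j hj) hij, inv_apply_self,
    R.apply_h_of_mem_specialFace hl hj]

/-- A face containing `R(Θ₁)` and `τ R(Θ₂)` contains the special face of the non-finite part of
`Θ₁ ∩ τ Θ₂`. -/
theorem IsFace.specialFace_interTranslate_subset {F : Set (Dual ℝ V)} (hF : R.IsFace F)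
    (hτ : τ ∈ R.weylGroup) (hL : ∀ j ∈ Θ₁, R.length τ ≤ R.length (R.s j * τ))
    (hR : ∀ j ∈ Θ₂, R.length τ ≤ R.length (τ * R.s j)) (h₁ : R.specialFace Θ₁ ⊆ F)
    (h₂ : τ '' R.specialFace Θ₂ ⊆ F) :
    R.specialFace (infPart A (R.interTranslate Θ₁ τ Θ₂)) ⊆ F := by
  obtain ⟨m₁, hm₁, hm₁0, hm₁1⟩ := R.exists_generic Θ₁
  obtain ⟨m₂, hm₂, hm₂0, hm₂1⟩ := R.exists_generic Θ₂
  -- With N large, N • m₁ + τ m₂ is positive on h i for i ∉ Θ₁, while on Θ₁ only τ m₂ contributes,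
  -- and it vanishes exactly on Θ₁ ∩ τ Θ₂.
  obtain ⟨N, hN, hNi⟩ := exists_pos_mul_add_pos (fun i => m₁ (R.h i)) fun i => τ m₂ (R.h i)
  have hp : ∀ i, (N • m₁ + τ m₂) (R.h i) = N * m₁ (R.h i) + τ m₂ (R.h i) := fun i => rfl
  have hpos : ∀ i ∉ Θ₁, 0 < (N • m₁ + τ m₂) (R.h i) := fun i hi =>
    hNi i (by rw [hm₁1 i hi]; exact one_pos)
  have hΘ₁ : ∀ i ∈ Θ₁, (N • m₁ + τ m₂) (R.h i) = τ m₂ (R.h i) := fun i hi => by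
    rw [hp, hm₁0 i hi, mul_zero, zero_add]
  refine hF.specialFace_infPart_subset R (p := N • m₁ + τ m₂) (fun i => ?_) (fun i => ?_) ?_
  · by_cases hi : i ∈ Θ₁
    · rw [hΘ₁ i hi]
      exact R.coroot_nonneg_apply hτ (hL i hi) hm₂
    · exact (hpos i hi).le
  · constructor
    · intro h
      by_cases hi : i ∈ Θ₁
      · rw [hΘ₁ i hi] at h
        exact R.mem_interTranslate hτ hi (hL i hi) hR hm₂ hm₂1 h
      · exact absurd h (hpos i hi).ne'
    · rintro ⟨hi, j, hj, hij⟩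
      rw [hΘ₁ i hi, ← R.coroot_eq_of_apply_α hτ (hR j hj) hij, inv_apply_self, hm₂0 j hj]
  · have hfacet : ∀ (Θ : Set I) (m : Dual ℝ V), m ∈ R.closedChamber →
        (∀ i ∈ Θ, m (R.h i) = 0) → ∀ t : ℝ, 0 ≤ t → t • m ∈ R.specialFace Θ :=
      fun Θ m hm hm0 t ht => ⟨1, one_mem _, t • m, ⟨fun i hi => by simp [hm0 i hi],
        fun i _ => mul_nonneg ht (hm i)⟩, rfl⟩
    have hconv : Convex ℝ F := hF.2.1
    -- The factors 2 offset the weights 1/2, so that the midpoint is the sum itself.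
    have h3 := hconv (h₁ (hfacet Θ₁ m₁ hm₁ hm₁0 (2 * N) (by positivity)))
      (h₂ ⟨_, hfacet Θ₂ m₂ hm₂ hm₂0 2 zero_le_two, rfl⟩) (a := 1 / 2) (b := 1 / 2)
      (by norm_num) (by norm_num) (by norm_num)
    rw [map_smul, smul_smul, smul_smul] at h3
    convert h3 using 2
    · congr 1; ring
    · norm_num

end KacMoody.Realization

end

/-! ### Assembly of the theorem -/

theorem mainTheorem7 {I : Type*} [Fintype I] {A : Matrix I I ℤ}
    {V : Type*} [AddCommGroup V] [Module ℝ V] [FiniteDimensional ℝ V]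
    (R : KacMoody.Realization A V) (Θ₁ Θ₂ : Set I)
    (hΘ₁ : KacMoody.IsSpecial A Θ₁) (hΘ₂ : KacMoody.IsSpecial A Θ₂)
    (τ : Module.Dual ℝ V ≃ₗ[ℝ] Module.Dual ℝ V)
    (hτ : τ ∈ R.minDoubleCosetReps
      (Θ₁ ∪ KacMoody.perp A Θ₁) (Θ₂ ∪ KacMoody.perp A Θ₂)) :
    -- the index sets on the right hand sides are special
    KacMoody.IsSpecial A (Θ₁ ∪ Θ₂ ∪ R.red τ) ∧
    KacMoody.IsSpecial A (KacMoody.infPart A (R.interTranslate Θ₁ τ Θ₂)) ∧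
    -- the intersection
    R.specialFace Θ₁ ∩ τ '' R.specialFace Θ₂ = R.specialFace (Θ₁ ∪ Θ₂ ∪ R.red τ) ∧
    -- the join in the poset of faces of the Tits cone
    ∃ (h₁ : R.IsFace (R.specialFace Θ₁)) (h₂ : R.IsFace (τ '' R.specialFace Θ₂))
      (h₃ : R.IsFace (R.specialFace (KacMoody.infPart A (R.interTranslate Θ₁ τ Θ₂)))),
      IsLUB ({⟨_, h₁⟩, ⟨_, h₂⟩} : Set R.Faces) ⟨_, h₃⟩ := by
  obtain ⟨hτW, hmin⟩ := hτ
  have hL : ∀ j ∈ Θ₁ ∪ KacMoody.perp A Θ₁, R.length τ ≤ R.length (R.s j * τ) := fun j hj => by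
    simpa using hmin _ (R.s_mem_parabolic hj) 1 (one_mem _)
  have hR : ∀ j ∈ Θ₂ ∪ KacMoody.perp A Θ₂, R.length τ ≤ R.length (τ * R.s j) := fun j hj => by
    simpa using hmin 1 (one_mem _) _ (R.s_mem_parabolic hj)
  have hL' : ∀ j ∈ Θ₁, R.length τ ≤ R.length (R.s j * τ) := fun j hj => hL j (Or.inl hj)
  have hR' : ∀ j ∈ Θ₂, R.length τ ≤ R.length (τ * R.s j) := fun j hj => hR j (Or.inl hj)
  obtain ⟨c₁, hc₁⟩ := R.isGCM.exists_isAntidominant hΘ₁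
  obtain ⟨c₂, hc₂⟩ := R.isGCM.exists_isAntidominant hΘ₂
  obtain ⟨c, -, -, hc, -⟩ := R.exists_isAntidominant_union hc₁ hc₂ hτW hL hR
  have hspec := R.isGCM.isSpecial_infPart (R.interTranslate Θ₁ τ Θ₂)
  refine ⟨hc.isSpecial R.isGCM, hspec, R.specialFace_inter_image hc₁ hc₂ hτW hL hR,
    R.isFace_specialFace hΘ₁, (R.isFace_specialFace hΘ₂).image R hτW,
    R.isFace_specialFace hspec, ?_, ?_⟩
  · rintro F (rfl | rfl)
    · exact R.specialFace_anti (KacMoody.infPart_subset.trans fun i hi => hi.1)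
    · exact R.image_specialFace_subset hτW hR'
  · rintro ⟨F, hF⟩ hub
    exact hF.specialFace_interTranslate_subset R hτW hL' hR' (hub (Or.inl rfl))
      (hub (Or.inr rfl))
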